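/- Let $h_j$ be the $j$-th (probabilists') Hermite polynomial, normalized so that $\mathbb{E}_{x\sim\mathcal N(0,1)}[h_j(x)^2]=1$. For a multiset $I$ of elements of $\{1,\dots,n\}$, with $I_k$ the multiplicity of $k$ in $I$ and $|I|=\sum_k I_k$, put $h_I(x)=\prod_{k=1}^n h_{I_k}(x_k)$ for $x\in\mathbb R^n$. Given $d\ge 1$ and independent points $p_1,\dots,p_m\sim\mathcal N(0,\mathrm{Id}_n)$ in $\mathbb R^n$, let $H$ be the matrix with entries $H_{Ii}=h_I(p_i)$, with rows indexed by the multisets $I$ with $0<|I|\le d$ and columns by $1\le i\le m$; let $C=\mathbb E_{p\sim\mathcal N(0,\mathrm{Id}_n)}\big[\sum_{0<|I|\le d}h_I(p)^2\big]$, and let $M=\frac1C H^{T}H$, an $m\times m$ matrix. Write $M=\mathrm{Id}+M'$, and let $M''$ be the off-diagonal part of $M$. Let $\|\cdot\|$ denote the Euclidean operator norm. **Theorem.** Let $d\ge 1$ be an integer. 1. For every $\delta>0$ there is a sequence $e_n\to 0$ (depending only on $d$ and $\delta$) such that for every $\beta>0$, all sufficiently large $n$ (depending on $d,\delta,\beta$)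 and all integers $0\le m\le n^{d-\delta}$, $$\Pr\big[\,\|M'\|\le e_n\,\big]\ \ge\ 1-n^{-\beta}.$$ 2. There is an integer $K\ge 0$ depending only on $d$ such that for all $\delta,\beta>0$, all sufficiently large $n$ (depending on $d,\delta,\beta$) and all integers $0\le m\le n^{d-\delta}$, $$\Pr\Big[\,\|M''\|\le (\log n)^{K}\,\frac{\sqrt m}{n^{d/2}}\,\Big]\ \ge\ 1-n^{-\beta}.$$ -/

import Mathlib

open MeasureTheory ProbabilityTheory Filter Topology

noncomputable section

/-- The `j`-th (probabilists') Hermite polynomial on `ℝ`, divided by `√(j!)`, its norm in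
`L²(𝒩(0,1))`. -/
def normHermite (j : ℕ) (x : ℝ) : ℝ :=
  Polynomial.aeval x (Polynomial.hermite j) / Real.sqrt (Nat.factorial j)

/-- Multisets `I` of elements of `{1, …, n}` with `0 < |I| ≤ d`: a size `k + 1` with `k < d`,
together with a multiset of that size. -/
abbrev HermiteIndex (n d : ℕ) : Type := Σ k : Fin d, Sym (Fin n) (k.val + 1)

/-- `h_I(x) = ∏ₖ h_{I_k}(x_k)`, where `I_k` is the multiplicity of `k` in `I`. -/
def multiHermite {n d : ℕ} (I : HermiteIndex n d) (x : Fin n → ℝ) : ℝ :=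
  ∏ k : Fin n, normHermite (Multiset.count k (I.2 : Multiset (Fin n))) (x k)

/-- The distribution `𝒩(0, Id)` on `ℝⁿ`, as a product of standard normal distributions. -/
def stdNormal (n : ℕ) : Measure (Fin n → ℝ) :=
  Measure.pi fun _ => gaussianReal 0 1

/-- The joint law of `m` independent points `p_1, …, p_m` of `ℝⁿ` distributed as `𝒩(0, Id)`. -/
def samplePoints (n m : ℕ) : Measure (Fin m → Fin n → ℝ) :=
  Measure.pi fun _ => stdNormal n

/-- `C`, the expected value of `∑_{0 < |I| ≤ d} h_I(p)²` for a point `p` with law `𝒩(0, Id)`. -/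
def interpC (n d : ℕ) : ℝ :=
  ∫ p, ∑ I : HermiteIndex n d, multiHermite I p ^ 2 ∂(stdNormal n)

/-- The matrix `H` with entries `H_{I i} = h_I(p_i)`. -/
def interpH {n m : ℕ} (d : ℕ) (p : Fin m → Fin n → ℝ) : Matrix (HermiteIndex n d) (Fin m) ℝ :=
  Matrix.of fun I i => multiHermite I (p i)

/-- The interpolation Gram matrix `M = HᵀH / C`. -/
def interpM {n m : ℕ} (d : ℕ) (p : Fin m → Fin n → ℝ) : Matrix (Fin m) (Fin m) ℝ :=
  (interpC n d)⁻¹ • ((interpH d p).transpose * interpH d p)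

/-- The off-diagonal part of a square matrix. -/
def offDiagPart {m : ℕ} (A : Matrix (Fin m) (Fin m) ℝ) : Matrix (Fin m) (Fin m) ℝ :=
  A - Matrix.diagonal A.diag

/-- The operator norm of a square matrix with respect to the Euclidean norm. -/
def opNorm {m : ℕ} (A : Matrix (Fin m) (Fin m) ℝ) : ℝ :=
  ‖Matrix.toEuclideanCLM (n := Fin m) (𝕜 := ℝ) A‖

end

namespace HermiteGram

section LinearAlgebra

open Matrix

variable {ι : Type*} [Fintype ι]

theorem sum_mul_sum_le_of_monovary (w f g : ι → ℝ) (hw : ∀ i, 0 ≤ w i)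
    (hfg : ∀ i j, 0 ≤ (f i - f j) * (g i - g j)) :
    (∑ i, w i * f i) * (∑ i, w i * g i) ≤ (∑ i, w i) * ∑ i, w i * (f i * g i) := by
  have h : 0 ≤ ∑ i, ∑ j, w i * w j * ((f i - f j) * (g i - g j)) :=
    Finset.sum_nonneg fun i _ => Finset.sum_nonneg fun j _ =>
      mul_nonneg (mul_nonneg (hw i) (hw j)) (hfg i j)
  have h2 : ∑ i, ∑ j, w i * w j * ((f i - f j) * (g i - g j)) =
      2 * ((∑ i, w i) * ∑ i, w i * (f i * g i) - (∑ i, w i * f i) * (∑ i, w i * g i)) := by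
    have e1 : (∑ i, w i) * ∑ i, w i * (f i * g i) = ∑ i, ∑ j, w i * (w j * (f j * g j)) :=
      Finset.sum_mul_sum _ _ _ _
    have e2 : (∑ i, w i) * ∑ i, w i * (f i * g i) = ∑ i, ∑ j, w j * (w i * (f i * g i)) := by
      rw [e1, Finset.sum_comm]
    have e3 : (∑ i, w i * f i) * (∑ i, w i * g i) = ∑ i, ∑ j, w i * f i * (w j * g j) :=
      Finset.sum_mul_sum _ _ _ _
    have e4 : (∑ i, w i * f i) * (∑ i, w i * g i) = ∑ i, ∑ j, w j * f j * (w i * g i) := by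
      rw [e3, Finset.sum_comm]
    have e5 : ∑ i, ∑ j, w i * w j * ((f i - f j) * (g i - g j)) =
        ∑ i, ∑ j, w i * (w j * (f j * g j)) + ∑ i, ∑ j, w j * (w i * (f i * g i))
        - ∑ i, ∑ j, w i * f i * (w j * g j) - ∑ i, ∑ j, w j * f j * (w i * g i) := by
      simp only [← Finset.sum_add_distrib, ← Finset.sum_sub_distrib]
      refine Finset.sum_congr rfl fun i _ => Finset.sum_congr rfl fun j _ => ?_
      ring
    rw [e5, ← e1, ← e2, ← e3, ← e4]
    ring
  linarith

theorem dotProduct_vecMulVec_mulVec (u v y z : ι → ℝ) :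
    u ⬝ᵥ (vecMulVec v y) *ᵥ z = (u ⬝ᵥ v) * (y ⬝ᵥ z) := by
  rw [vecMulVec_mulVec, dotProduct_smul]
  simp

variable [DecidableEq ι]

theorem dotProduct_diagonal_mulVec (l y : ι → ℝ) :
    y ⬝ᵥ (diagonal l) *ᵥ y = ∑ i, y i ^ 2 * l i := by
  simp only [dotProduct, mulVec_diagonal]
  exact Finset.sum_congr rfl fun i _ => by ring

theorem dotProduct_diagonal_add_vecMulVec_pow_le (l y : ι → ℝ) (hl : ∀ i, 0 ≤ l i) (r : ℝ)
    (hr : y ⬝ᵥ y ≤ r) (n a : ℕ) :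
    y ⬝ᵥ ((diagonal l + vecMulVec y y) ^ n * diagonal l ^ a) *ᵥ y ≤
      ∑ i, y i ^ 2 * (l i ^ a * (l i + r) ^ n) := by
  have hr0 : 0 ≤ r := le_trans (by
    simpa [dotProduct] using Finset.sum_nonneg fun i _ => mul_self_nonneg (y i)) hr
  induction n generalizing a with
  | zero => simp [diagonal_pow, dotProduct_diagonal_mulVec]
  | succ n ih =>
    have e : (diagonal l + vecMulVec y y) ^ (n + 1) * diagonal l ^ a =
        (diagonal l + vecMulVec y y) ^ n * diagonal l ^ (a + 1) +
        (diagonal l + vecMulVec y y) ^ n * (vecMulVec y y * diagonal l ^ a) := by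
      rw [pow_succ, mul_assoc, add_mul, mul_add, pow_succ' _ a]
    have e2 : y ⬝ᵥ ((diagonal l + vecMulVec y y) ^ n * (vecMulVec y y * diagonal l ^ a)) *ᵥ y =
        (y ⬝ᵥ ((diagonal l + vecMulVec y y) ^ n) *ᵥ y) * ∑ i, y i ^ 2 * l i ^ a := by
      rw [vecMulVec_mul, mul_vecMulVec, dotProduct_vecMulVec_mulVec, ← dotProduct_mulVec,
        diagonal_pow, dotProduct_diagonal_mulVec]
      rfl
    rw [e, add_mulVec, dotProduct_add, e2]
    have h0 := ih 0
    simp only [pow_zero, mul_one, one_mul] at h0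
    have hb : 0 ≤ ∑ i, y i ^ 2 * l i ^ a :=
      Finset.sum_nonneg fun i _ => mul_nonneg (sq_nonneg _) (pow_nonneg (hl i) _)
    have hc : 0 ≤ ∑ i, y i ^ 2 * ((l i + r) ^ n * l i ^ a) :=
      Finset.sum_nonneg fun i _ => mul_nonneg (sq_nonneg _)
        (mul_nonneg (pow_nonneg (add_nonneg (hl i) hr0) _) (pow_nonneg (hl i) _))
    have hch := sum_mul_sum_le_of_monovary (fun i => y i ^ 2) (fun i => (l i + r) ^ n)
      (fun i => l i ^ a) (fun i => sq_nonneg _) (by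
        intro i j
        rcases le_total (l i) (l j) with h | h
        · apply mul_nonneg_of_nonpos_of_nonpos
          · exact sub_nonpos.2 (pow_le_pow_left₀ (add_nonneg (hl i) hr0) (by linarith) _)
          · exact sub_nonpos.2 (pow_le_pow_left₀ (hl i) h _)
        · apply mul_nonneg
          · exact sub_nonneg.2 (pow_le_pow_left₀ (add_nonneg (hl j) hr0) (by linarith) _)
          · exact sub_nonneg.2 (pow_le_pow_left₀ (hl j) h _))
    have hyy : ∑ i, y i ^ 2 ≤ r := by
      refine le_trans (le_of_eq ?_) hr
      exact Finset.sum_congr rfl fun i _ => sq _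
    calc _ ≤ ∑ i, y i ^ 2 * (l i ^ (a + 1) * (l i + r) ^ n) +
          (∑ i, y i ^ 2 * (l i + r) ^ n) * ∑ i, y i ^ 2 * l i ^ a :=
          add_le_add (ih (a + 1)) (mul_le_mul_of_nonneg_right h0 hb)
      _ ≤ ∑ i, y i ^ 2 * (l i ^ (a + 1) * (l i + r) ^ n) +
          r * ∑ i, y i ^ 2 * ((l i + r) ^ n * l i ^ a) := by
          refine add_le_add le_rfl ?_
          exact hch.trans (mul_le_mul_of_nonneg_right hyy hc)
      _ = _ := by
          rw [Finset.mul_sum, ← Finset.sum_add_distrib]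
          exact Finset.sum_congr rfl fun i _ => by ring

theorem trace_diagonal_pow_mul_le (l y : ι → ℝ) (hl : ∀ i, 0 ≤ l i) (r : ℝ)
    (hr : y ⬝ᵥ y ≤ r) (n a : ℕ) :
    trace (diagonal l ^ a * (diagonal l + vecMulVec y y) ^ n) ≤
      trace (diagonal l ^ (a + n)) + n * ∑ i, y i ^ 2 * (l i + r) ^ (a + n - 1) := by
  have hr0 : 0 ≤ r := le_trans (by
    simpa [dotProduct] using Finset.sum_nonneg fun i _ => mul_self_nonneg (y i)) hr
  induction n generalizing a with
  | zero => simp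
  | succ n ih =>
    have e : diagonal l ^ a * (diagonal l + vecMulVec y y) ^ (n + 1) =
        diagonal l ^ (a + 1) * (diagonal l + vecMulVec y y) ^ n +
        diagonal l ^ a * vecMulVec y y * (diagonal l + vecMulVec y y) ^ n := by
      rw [pow_succ', add_mul, mul_add, pow_succ (diagonal l) a, mul_assoc, mul_assoc]
    have e2 : trace (diagonal l ^ a * vecMulVec y y * (diagonal l + vecMulVec y y) ^ n) =
        y ⬝ᵥ ((diagonal l + vecMulVec y y) ^ n * diagonal l ^ a) *ᵥ y := by
      rw [mul_vecMulVec, vecMulVec_mul, trace_vecMulVec, dotProduct_comm, ← dotProduct_mulVec,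
        mulVec_mulVec]
    rw [e, trace_add, e2]
    have h1 := ih (a + 1)
    have h2 : ∑ i, y i ^ 2 * (l i ^ a * (l i + r) ^ n) ≤ ∑ i, y i ^ 2 * (l i + r) ^ (a + n) := by
      refine Finset.sum_le_sum fun i _ => mul_le_mul_of_nonneg_left ?_ (sq_nonneg _)
      rw [pow_add]
      refine mul_le_mul_of_nonneg_right (pow_le_pow_left₀ (hl i) (by linarith) _)
        (pow_nonneg (add_nonneg (hl i) hr0) _)
    have h3 := dotProduct_diagonal_add_vecMulVec_pow_le l y hl r hr n a
    have e3 : a + 1 + n = a + (n + 1) := by omega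
    have e4 : a + (n + 1) - 1 = a + n := by omega
    rw [e3, e4] at h1
    rw [e4]
    push_cast
    linarith

theorem exists_orthogonal_diagonalization {S : Matrix ι ι ℝ} (hS : Sᵀ = S) {c : ℝ}
    (hc : ∀ v, c * (v ⬝ᵥ v) ≤ v ⬝ᵥ S *ᵥ v) :
    ∃ (U : Matrix ι ι ℝ) (l : ι → ℝ), Uᵀ * U = 1 ∧ U * Uᵀ = 1 ∧
      S = U * diagonal l * Uᵀ ∧ ∀ i, c ≤ l i := by
  have hH : S.IsHermitian := by
    rw [IsHermitian, conjTranspose_eq_transpose_of_trivial, hS]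
  set U : Matrix ι ι ℝ := hH.eigenvectorUnitary.1
  have hU1 : Uᵀ * U = 1 := by
    have := Unitary.coe_star_mul_self hH.eigenvectorUnitary
    rwa [star_eq_conjTranspose, conjTranspose_eq_transpose_of_trivial] at this
  have hU2 : U * Uᵀ = 1 := mul_eq_one_comm.1 hU1
  have hSU : S = U * diagonal hH.eigenvalues * Uᵀ := by
    have h := hH.spectral_theorem
    rw [Unitary.conjStarAlgAut_apply, star_eq_conjTranspose,
      conjTranspose_eq_transpose_of_trivial] at h
    exact h
  clear_value U
  generalize hH.eigenvalues = l at hSU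
  refine ⟨U, l, hU1, hU2, hSU, fun i => ?_⟩
  have h := hc (U *ᵥ Pi.single i 1)
  have hd : Uᵀ * S * U = diagonal l := by
    rw [hSU]
    simp only [← mul_assoc]
    rw [hU1, one_mul, mul_assoc, hU1, mul_one]
  have e1 : (U *ᵥ Pi.single i 1) ⬝ᵥ (U *ᵥ Pi.single i 1) = 1 := by
    rw [dotProduct_mulVec, vecMul_mulVec, hU1]
    simp
  have e2 : (U *ᵥ Pi.single i 1) ⬝ᵥ S *ᵥ (U *ᵥ Pi.single i 1) = l i := by
    rw [mulVec_mulVec, dotProduct_mulVec, vecMul_mulVec, ← mul_assoc, hd]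
    simp
  rwa [e1, e2, mul_one] at h

theorem conj_diagonal_pow {U : Matrix ι ι ℝ} (hU : Uᵀ * U = 1) (hU' : U * Uᵀ = 1)
    (A : Matrix ι ι ℝ) (n : ℕ) : (U * A * Uᵀ) ^ n = U * A ^ n * Uᵀ := by
  induction n with
  | zero => simp [hU']
  | succ n ih =>
    rw [pow_succ, ih, pow_succ]
    calc U * A ^ n * Uᵀ * (U * A * Uᵀ) = U * A ^ n * (Uᵀ * U) * A * Uᵀ := by
          simp only [mul_assoc]
      _ = _ := by rw [hU, mul_one]; simp only [mul_assoc]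

theorem trace_conj {U : Matrix ι ι ℝ} (hU : Uᵀ * U = 1)
    (A : Matrix ι ι ℝ) : trace (U * A * Uᵀ) = trace A := by
  rw [trace_mul_comm, ← mul_assoc, hU, one_mul]

omit [DecidableEq ι] in
theorem dotProduct_conj_mulVec (U A : Matrix ι ι ℝ) (x : ι → ℝ) :
    x ⬝ᵥ (U * A * Uᵀ) *ᵥ x = (Uᵀ *ᵥ x) ⬝ᵥ A *ᵥ (Uᵀ *ᵥ x) := by
  rw [← mulVec_mulVec, ← mulVec_mulVec, dotProduct_mulVec, ← mulVec_transpose]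

theorem trace_add_vecMulVec_pow_le {S : Matrix ι ι ℝ} (hS : Sᵀ = S) {c r : ℝ} (hc0 : 0 ≤ c)
    (hc : ∀ v, c * (v ⬝ᵥ v) ≤ v ⬝ᵥ S *ᵥ v) (x : ι → ℝ) (hr : x ⬝ᵥ x ≤ r) {q Q : ℕ}
    (hqQ : q + 1 ≤ Q) (hcr : Q * r ≤ c) :
    trace ((S + vecMulVec x x) ^ (q + 1)) ≤
      trace (S ^ (q + 1)) + (q + 1) * (Real.exp 1 * (x ⬝ᵥ (S ^ q) *ᵥ x)) := by
  obtain ⟨U, l, hU, hU', hSU, hl⟩ := exists_orthogonal_diagonalization hS hc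
  have hl0 : ∀ i, 0 ≤ l i := fun i => hc0.trans (hl i)
  set y := Uᵀ *ᵥ x with hy
  have hyy : y ⬝ᵥ y = x ⬝ᵥ x := by
    rw [hy, dotProduct_mulVec, vecMul_mulVec, transpose_transpose, hU', vecMul_one]
  have hxy : vecMulVec x x = U * vecMulVec y y * Uᵀ := by
    rw [mul_vecMulVec, vecMulVec_mul, vecMul_transpose, hy, mulVec_mulVec, hU', one_mulVec]
  have e1 : S + vecMulVec x x = U * (diagonal l + vecMulVec y y) * Uᵀ := by
    rw [hxy, mul_add, add_mul, ← hSU]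
  rw [e1, conj_diagonal_pow hU hU', trace_conj hU, hSU, conj_diagonal_pow hU hU', trace_conj hU,
    conj_diagonal_pow hU hU', dotProduct_conj_mulVec, ← hy, diagonal_pow l q,
    dotProduct_diagonal_mulVec]
  have h := trace_diagonal_pow_mul_le l y hl0 r (hyy.trans_le hr) (q + 1) 0
  simp only [pow_zero, one_mul, zero_add, Nat.add_sub_cancel] at h
  refine h.trans ?_
  push_cast
  gcongr
  rw [Finset.mul_sum]
  refine Finset.sum_le_sum fun i _ => ?_
  have hr0 : 0 ≤ r := le_trans (by
    simpa [dotProduct] using Finset.sum_nonneg fun i _ => mul_self_nonneg (x i)) hr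
  have key : (l i + r) ^ q ≤ Real.exp 1 * l i ^ q := by
    have hQ0 : (0 : ℝ) < Q := by exact_mod_cast (by omega : 0 < Q)
    have h1 : r ≤ l i / Q := by
      rw [le_div_iff₀ hQ0]
      linarith [hl i]
    have h2 : l i + r ≤ l i * Real.exp (1 / Q) := by
      have := Real.add_one_le_exp (1 / (Q : ℝ))
      calc l i + r ≤ l i * (1 / Q + 1) := by
            have : l i / Q = l i * (1 / Q) := by ring
            nlinarith
        _ ≤ _ := mul_le_mul_of_nonneg_left this (hl0 i)
    calc (l i + r) ^ q ≤ (l i * Real.exp (1 / Q)) ^ q :=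
          pow_le_pow_left₀ (add_nonneg (hl0 i) hr0) h2 _
      _ = Real.exp (q * (1 / Q)) * l i ^ q := by rw [mul_pow, ← Real.exp_nat_mul, mul_comm]
      _ ≤ _ := by
        refine mul_le_mul_of_nonneg_right (Real.exp_le_exp.2 ?_) (pow_nonneg (hl0 i) _)
        rw [mul_one_div, div_le_one hQ0]
        exact_mod_cast (by omega : q ≤ Q)
  have : y i ^ 2 * (l i + r) ^ q ≤ y i ^ 2 * (Real.exp 1 * l i ^ q) :=
    mul_le_mul_of_nonneg_left key (sq_nonneg _)
  simp only [Pi.pow_apply]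
  linarith

theorem dotProduct_mulVec_le_of_trace_pow_lt {S : Matrix ι ι ℝ} (hS : Sᵀ = S)
    (hc : ∀ v, 0 ≤ v ⬝ᵥ S *ᵥ v) {t : ℝ} (ht : 0 ≤ t) {q : ℕ}
    (h : trace (S ^ q) < t ^ q) (u : ι → ℝ) : u ⬝ᵥ S *ᵥ u ≤ t * (u ⬝ᵥ u) := by
  obtain ⟨U, l, hU, hU', hSU, hl⟩ := exists_orthogonal_diagonalization (c := 0) hS (by simpa using hc)
  rw [hSU, conj_diagonal_pow hU hU', trace_conj hU, diagonal_pow, trace_diagonal] at h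
  have hlt : ∀ i, l i ≤ t := by
    intro i
    by_contra! hi
    have h1 : t ^ q ≤ l i ^ q := pow_le_pow_left₀ ht hi.le _
    have h2 : (l ^ q) i ≤ ∑ i, (l ^ q) i :=
      Finset.single_le_sum (f := l ^ q) (fun j _ => pow_nonneg (hl j) _) (Finset.mem_univ i)
    simp only [Pi.pow_apply] at h2 h
    linarith
  have hyy : (Uᵀ *ᵥ u) ⬝ᵥ (Uᵀ *ᵥ u) = u ⬝ᵥ u := by
    rw [dotProduct_mulVec, vecMul_mulVec, transpose_transpose, hU', vecMul_one]
  rw [hSU, dotProduct_conj_mulVec, dotProduct_diagonal_mulVec, ← hyy, dotProduct, Finset.mul_sum]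
  refine Finset.sum_le_sum fun i _ => ?_
  nlinarith [hlt i, sq_nonneg ((Uᵀ *ᵥ u) i)]

end LinearAlgebra

section Moments

open Matrix

theorem measurePreserving_update {m : ℕ} {X : Type*} [MeasurableSpace X] (μ : Measure X)
    [IsProbabilityMeasure μ] (k : Fin m) :
    MeasurePreserving (fun z : (Fin m → X) × X => Function.update z.1 k z.2)
      ((Measure.pi fun _ => μ).prod μ) (Measure.pi fun _ => μ) := by
  have hm : Measurable (fun z : (Fin m → X) × X => Function.update z.1 k z.2) := by
    refine measurable_pi_iff.2 fun i => ?_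
    by_cases h : i = k
    · subst h; simpa using measurable_snd
    · simp only [Function.update_of_ne h]
      exact (measurable_pi_apply (X := fun _ : Fin m => X) i).comp
        (measurable_fst (α := Fin m → X) (β := X))
  refine ⟨hm, (Measure.pi_eq fun s hs => ?_).symm⟩
  rw [Measure.map_apply hm (MeasurableSet.univ_pi hs)]
  have : (fun z : (Fin m → X) × X => Function.update z.1 k z.2) ⁻¹' (Set.univ.pi s) =
      (Set.univ.pi (Function.update s k Set.univ)) ×ˢ s k := by
    ext z
    simp only [Set.mem_preimage, Set.mem_pi, Set.mem_univ, true_implies, Set.mem_prod]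
    constructor
    · intro h
      refine ⟨fun i => ?_, by simpa using h k⟩
      by_cases hi : i = k
      · subst hi; simp
      · simpa [Function.update_of_ne hi] using h i
    · rintro ⟨h1, h2⟩ i
      by_cases hi : i = k
      · subst hi; simpa using h2
      · simpa [Function.update_of_ne hi] using h1 i
  rw [this, Measure.prod_prod, Measure.pi_pi, ← Finset.mul_prod_erase _ _ (Finset.mem_univ k),
    ← Finset.mul_prod_erase _ (fun i => μ (s i)) (Finset.mem_univ k)]
  simp only [Function.update_self, measure_univ, one_mul]
  rw [mul_comm]
  congr 1
  refine Finset.prod_congr rfl fun i hi => ?_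
  rw [Function.update_of_ne (Finset.ne_of_mem_erase hi)]

theorem integral_pi_eq_integral_update {m : ℕ} {X : Type*} [MeasurableSpace X] (μ : Measure X)
    [IsProbabilityMeasure μ] (k : Fin m) {f : (Fin m → X) → ℝ}
    (hf : Integrable f (Measure.pi fun _ => μ)) :
    Integrable (fun p => ∫ ω, f (Function.update p k ω) ∂μ) (Measure.pi fun _ => μ) ∧
    ∫ p, f p ∂(Measure.pi fun _ => μ) =
      ∫ p, ∫ ω, f (Function.update p k ω) ∂μ ∂(Measure.pi fun _ => μ) := by
  have hmp := measurePreserving_update μ k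
  have hi := (hmp.integrable_comp hf.aestronglyMeasurable).2 hf
  refine ⟨hi.integral_prod_left, ?_⟩
  refine Eq.trans ?_ (integral_prod _ hi)
  nth_rewrite 1 [← hmp.map_eq]
  rw [integral_map hmp.measurable.aemeasurable
    (by rw [hmp.map_eq]; exact hf.aestronglyMeasurable)]
  rfl

theorem integrable_comp_of_bounded {Ω E : Type*} [MeasurableSpace Ω] {P : Measure Ω}
    [IsFiniteMeasure P] [NormedAddCommGroup E] [ProperSpace E] [MeasurableSpace E] [BorelSpace E]
    {Y : Ω → E} (hY : Measurable Y) {C : ℝ} (hC : ∀ ω, ‖Y ω‖ ≤ C) {f : E → ℝ}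
    (hf : Continuous f) : Integrable (fun ω => f (Y ω)) P := by
  obtain ⟨B, hB⟩ := (isCompact_closedBall (0 : E) C).exists_bound_of_continuousOn hf.continuousOn
  refine Integrable.of_bound (hf.measurable.comp hY).aestronglyMeasurable B
    (ae_of_all _ fun ω => hB _ ?_)
  simpa using hC ω

variable {ι : Type*} [Fintype ι]

theorem norm_le_sqrt_of_dotProduct_le {v : ι → ℝ} {R : ℝ} (h : v ⬝ᵥ v ≤ R) : ‖v‖ ≤ √R := by
  refine (pi_norm_le_iff_of_nonneg (Real.sqrt_nonneg _)).2 fun i => ?_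
  refine Real.abs_le_sqrt (le_trans ?_ h)
  rw [sq]
  exact Finset.single_le_sum (f := fun i => v i * v i) (fun j _ => mul_self_nonneg (v j))
    (Finset.mem_univ i)

variable [DecidableEq ι]

/-- The shifted partial Gram sum `c • 1 + ∑_{j < k} x_j x_jᵀ`. -/
noncomputable def shiftedGram {Ω : Type*} (c : ℝ) (x : ℕ → Ω → ι → ℝ) (k : ℕ) (p : Ω) :
    Matrix ι ι ℝ :=
  c • 1 + ∑ j ∈ Finset.range k, vecMulVec (x j p) (x j p)

omit [Fintype ι] in
theorem shiftedGram_succ {Ω : Type*} (c : ℝ) (x : ℕ → Ω → ι → ℝ) (k : ℕ) (p : Ω) :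
    shiftedGram c x (k + 1) p = shiftedGram c x k p + vecMulVec (x k p) (x k p) := by
  rw [shiftedGram, shiftedGram, Finset.sum_range_succ, add_assoc]

omit [Fintype ι] in
theorem shiftedGram_transpose {Ω : Type*} (c : ℝ) (x : ℕ → Ω → ι → ℝ) (k : ℕ) (p : Ω) :
    (shiftedGram c x k p)ᵀ = shiftedGram c x k p := by
  simp [shiftedGram, transpose_sum, transpose_vecMulVec]

theorem dotProduct_shiftedGram_mulVec {Ω : Type*} (c : ℝ) (x : ℕ → Ω → ι → ℝ) (k : ℕ) (p : Ω)
    (u : ι → ℝ) : u ⬝ᵥ shiftedGram c x k p *ᵥ u =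
      c * (u ⬝ᵥ u) + ∑ j ∈ Finset.range k, (x j p ⬝ᵥ u) ^ 2 := by
  rw [shiftedGram, add_mulVec, dotProduct_add, smul_mulVec, one_mulVec, dotProduct_smul,
    sum_mulVec, dotProduct_sum, smul_eq_mul]
  congr 1
  refine Finset.sum_congr rfl fun j _ => ?_
  rw [dotProduct_vecMulVec_mulVec, dotProduct_comm, sq]

theorem le_dotProduct_shiftedGram_mulVec {Ω : Type*} (c : ℝ) (x : ℕ → Ω → ι → ℝ) (k : ℕ) (p : Ω)
    (u : ι → ℝ) : c * (u ⬝ᵥ u) ≤ u ⬝ᵥ shiftedGram c x k p *ᵥ u := by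
  rw [dotProduct_shiftedGram_mulVec]
  exact le_add_of_nonneg_right (Finset.sum_nonneg fun _ _ => sq_nonneg _)

theorem integral_dotProduct_pow_mulVec_le {Ω : Type*} [MeasurableSpace Ω] (P : Measure Ω)
    {S : Matrix ι ι ℝ} (hS : Sᵀ = S) (hc : ∀ v, 0 ≤ v ⬝ᵥ S *ᵥ v) {σ : ℝ} (v : Ω → ι → ℝ)
    (hint : ∀ u, Integrable (fun ω => (v ω ⬝ᵥ u) ^ 2) P)
    (hσ : ∀ u, ∫ ω, (v ω ⬝ᵥ u) ^ 2 ∂P ≤ σ * (u ⬝ᵥ u)) (q : ℕ) :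
    ∫ ω, v ω ⬝ᵥ (S ^ q) *ᵥ v ω ∂P ≤ σ * trace (S ^ q) := by
  obtain ⟨U, l, hU, hU', hSU, hl⟩ := exists_orthogonal_diagonalization (c := 0) hS (by simpa using hc)
  rw [hSU, conj_diagonal_pow hU hU', trace_conj hU, diagonal_pow, trace_diagonal]
  have e : ∀ ω i, (Uᵀ *ᵥ v ω) i = v ω ⬝ᵥ (fun j => U j i) := fun ω i => by
    simp [mulVec, dotProduct, mul_comm]
  simp only [dotProduct_conj_mulVec, dotProduct_diagonal_mulVec, e]
  rw [integral_finsetSum _ fun i _ => (hint _).mul_const _, Finset.mul_sum]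
  refine Finset.sum_le_sum fun i _ => ?_
  rw [integral_mul_const]
  refine mul_le_mul_of_nonneg_right ((hσ _).trans_eq ?_) (pow_nonneg (hl i) q)
  have : (fun j => U j i) ⬝ᵥ (fun j => U j i) = (Uᵀ * U) i i := by
    simp [mul_apply, dotProduct]
  rw [this, hU, one_apply_eq, mul_one]

variable {X : Type*} [MeasurableSpace X] (μ : Measure X) [IsProbabilityMeasure μ]

theorem integrable_trace_shiftedGram_pow {Ω : Type*} [MeasurableSpace Ω] (P : Measure Ω)
    [IsFiniteMeasure P] {x : ℕ → Ω → ι → ℝ} {R : ℝ} (hmeas : ∀ k, Measurable (x k))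
    (hR : ∀ k p, x k p ⬝ᵥ x k p ≤ R) (c : ℝ) (k q : ℕ) :
    Integrable (fun p => trace (shiftedGram c x k p ^ q)) P := by
  have := integrable_comp_of_bounded (P := P) (E := Fin k → ι → ℝ)
    (Y := fun p j => x j p) (measurable_pi_iff.2 fun j => hmeas j) (C := √R)
    (fun p => (pi_norm_le_iff_of_nonneg (Real.sqrt_nonneg _)).2 fun j =>
      norm_le_sqrt_of_dotProduct_le (hR j p))
    (f := fun v => trace ((c • 1 + ∑ j, vecMulVec (v j) (v j)) ^ q)) (by fun_prop)
  refine this.congr (ae_of_all _ fun p => ?_)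
  simp only [shiftedGram, Finset.sum_range]

theorem integrable_dotProduct_shiftedGram_pow {Ω : Type*} [MeasurableSpace Ω] (P : Measure Ω)
    [IsFiniteMeasure P] {x : ℕ → Ω → ι → ℝ} {R : ℝ} (hmeas : ∀ k, Measurable (x k))
    (hR : ∀ k p, x k p ⬝ᵥ x k p ≤ R) (c : ℝ) (k q : ℕ) :
    Integrable (fun p => x k p ⬝ᵥ (shiftedGram c x k p ^ q) *ᵥ x k p) P := by
  have := integrable_comp_of_bounded (P := P) (E := Fin (k + 1) → ι → ℝ)
    (Y := fun p j => x j p) (measurable_pi_iff.2 fun j => hmeas j) (C := √R)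
    (fun p => (pi_norm_le_iff_of_nonneg (Real.sqrt_nonneg _)).2 fun j =>
      norm_le_sqrt_of_dotProduct_le (hR j p))
    (f := fun v => v (Fin.last k) ⬝ᵥ
      ((c • 1 + ∑ j : Fin k, vecMulVec (v j.castSucc) (v j.castSucc)) ^ q) *ᵥ v (Fin.last k))
    (by fun_prop)
  refine this.congr (ae_of_all _ fun p => ?_)
  simp [shiftedGram, Finset.sum_range]

theorem integral_trace_shiftedGram_pow_le {m : ℕ} {x : ℕ → (Fin m → X) → ι → ℝ} {R σ : ℝ}
    (hR0 : 0 ≤ R) (hσ0 : 0 ≤ σ) (hmeas : ∀ k, Measurable (x k))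
    (hR : ∀ k p, x k p ⬝ᵥ x k p ≤ R)
    (hadapt : ∀ (k : Fin m) (j : ℕ), j < k → ∀ p ω, x j (Function.update p k ω) = x j p)
    (hσ : ∀ (k : Fin m) p u,
      ∫ ω, (x k (Function.update p k ω) ⬝ᵥ u) ^ 2 ∂μ ≤ σ * (u ⬝ᵥ u))
    (Q k : ℕ) (hk : k ≤ m) (q : ℕ) (hq : q ≤ Q) :
    ∫ p, trace (shiftedGram (Q * R) x k p ^ q) ∂(Measure.pi fun _ => μ) ≤
      Fintype.card ι * (Q * R + Real.exp 1 * σ * k) ^ q := by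
  induction k generalizing q with
  | zero =>
    simp [shiftedGram, smul_pow, trace_smul, mul_comm]
  | succ k ih =>
    cases q with
    | zero => simp
    | succ q =>
      set π := Measure.pi fun _ : Fin m => μ
      set c : ℝ := Q * R with hc
      have hc0 : 0 ≤ c := by positivity
      have hpos : ∀ p v, 0 ≤ v ⬝ᵥ shiftedGram c x k p *ᵥ v := fun p v =>
        le_trans (mul_nonneg hc0 (Finset.sum_nonneg fun i _ => mul_self_nonneg (v i)))
          (le_dotProduct_shiftedGram_mulVec c x k p v)
      have h1 : ∫ p, trace (shiftedGram c x (k + 1) p ^ (q + 1)) ∂π ≤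
          ∫ p, (trace (shiftedGram c x k p ^ (q + 1)) + (q + 1) * (Real.exp 1 *
            (x k p ⬝ᵥ (shiftedGram c x k p ^ q) *ᵥ x k p))) ∂π := by
        refine integral_mono (integrable_trace_shiftedGram_pow π hmeas hR _ _ _)
          ((integrable_trace_shiftedGram_pow π hmeas hR _ _ _).add
          (((integrable_dotProduct_shiftedGram_pow π hmeas hR _ _ _).const_mul _).const_mul _))
          fun p => ?_
        simp only [shiftedGram_succ]
        exact trace_add_vecMulVec_pow_le (shiftedGram_transpose c x k p) hc0
          (le_dotProduct_shiftedGram_mulVec c x k p) (x k p) (hR k p) hq le_rfl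
      rw [integral_add (integrable_trace_shiftedGram_pow π hmeas hR _ _ _)
          (((integrable_dotProduct_shiftedGram_pow π hmeas hR _ _ _).const_mul _).const_mul _),
        integral_const_mul, integral_const_mul] at h1
      have h2 : ∫ p, x k p ⬝ᵥ (shiftedGram c x k p ^ q) *ᵥ x k p ∂π ≤
          σ * ∫ p, trace (shiftedGram c x k p ^ q) ∂π := by
        have hi := integrable_dotProduct_shiftedGram_pow π hmeas hR c k q
        have hS : ∀ p ω, shiftedGram c x k (Function.update p (⟨k, hk⟩ : Fin m) ω) =
            shiftedGram c x k p := fun p ω => by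
          unfold shiftedGram
          congr 1
          refine Finset.sum_congr rfl fun j hj => ?_
          rw [hadapt ⟨k, hk⟩ j (Finset.mem_range.1 hj)]
        obtain ⟨hi2, hi3⟩ := integral_pi_eq_integral_update μ (⟨k, hk⟩ : Fin m) hi
        rw [hi3, ← integral_const_mul]
        refine integral_mono hi2
          ((integrable_trace_shiftedGram_pow π hmeas hR _ _ _).const_mul _) fun p => ?_
        simp only [hS]
        refine integral_dotProduct_pow_mulVec_le μ (shiftedGram_transpose c x k p) (hpos p) _
          (fun u => ?_) (hσ ⟨k, hk⟩ p) q
        refine integrable_comp_of_bounded (E := ι → ℝ) ((hmeas k).comp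
          (measurable_update p)) (C := √R)
          (fun ω => norm_le_sqrt_of_dotProduct_le (hR k _)) (f := fun v => (v ⬝ᵥ u) ^ 2) (by fun_prop)
      have h3 := ih (by omega) (q + 1) hq
      have h4 := ih (by omega) q (by omega)
      set L : ℝ := c + Real.exp 1 * σ * k with hL
      have hL0 : 0 ≤ L := by positivity
      have h5 : L ^ (q + 1) + (q + 1) * (Real.exp 1 * (σ * L ^ q)) ≤
          (L + Real.exp 1 * σ) ^ (q + 1) := by
        have hb : 0 ≤ Real.exp 1 * σ := by positivity
        have := pow_add_mul_le_add_pow (a := L) (b := Real.exp 1 * σ) hL0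
          (by positivity) (q + 1)
        simp only [Nat.add_sub_cancel] at this
        push_cast at this
        linarith
      calc _ ≤ Fintype.card ι * L ^ (q + 1) +
            (q + 1) * (Real.exp 1 * (σ * (Fintype.card ι * L ^ q))) := by
            refine h1.trans (add_le_add h3 ?_)
            gcongr
            exact h2.trans (mul_le_mul_of_nonneg_left h4 hσ0)
        _ = Fintype.card ι * (L ^ (q + 1) + (q + 1) * (Real.exp 1 * (σ * L ^ q))) := by ring
        _ ≤ Fintype.card ι * (L + Real.exp 1 * σ) ^ (q + 1) := by gcongr
        _ = _ := by rw [hL]; push_cast; ring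

theorem measureReal_exists_lt_sum_sq_le {m : ℕ} {x : ℕ → (Fin m → X) → ι → ℝ} {R σ : ℝ}
    (hR0 : 0 < R) (hσ0 : 0 ≤ σ) (hmeas : ∀ k, Measurable (x k))
    (hR : ∀ k p, x k p ⬝ᵥ x k p ≤ R)
    (hadapt : ∀ (k : Fin m) (j : ℕ), j < k → ∀ p ω, x j (Function.update p k ω) = x j p)
    (hσ : ∀ (k : Fin m) p u,
      ∫ ω, (x k (Function.update p k ω) ⬝ᵥ u) ^ 2 ∂μ ≤ σ * (u ⬝ᵥ u))
    {Q : ℕ} (hQ : 0 < Q) :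
    (Measure.pi fun _ : Fin m => μ).real {p | ∃ u : ι → ℝ,
      Real.exp 1 * (Q * R + Real.exp 1 * σ * m) * (u ⬝ᵥ u) <
        ∑ k ∈ Finset.range m, (x k p ⬝ᵥ u) ^ 2} ≤ Fintype.card ι * Real.exp (-Q) := by
  set π := Measure.pi fun _ : Fin m => μ
  set L := Q * R + Real.exp 1 * σ * m
  have hL : 0 < L := by positivity
  set c : ℝ := Q * R
  have hc0 : 0 ≤ c := by positivity
  have hpos : ∀ p v, 0 ≤ v ⬝ᵥ shiftedGram c x m p *ᵥ v := fun p v =>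
    le_trans (mul_nonneg hc0 (Finset.sum_nonneg fun i _ => mul_self_nonneg (v i)))
      (le_dotProduct_shiftedGram_mulVec c x m p v)
  have hsub : {p | ∃ u : ι → ℝ, Real.exp 1 * L * (u ⬝ᵥ u) <
      ∑ k ∈ Finset.range m, (x k p ⬝ᵥ u) ^ 2} ⊆
      {p | (Real.exp 1 * L) ^ Q ≤ trace (shiftedGram c x m p ^ Q)} := by
    rintro p ⟨u, hu⟩
    by_contra! h
    simp only [Set.mem_ofPred_eq, not_le] at h
    have h2 := dotProduct_mulVec_le_of_trace_pow_lt (shiftedGram_transpose c x m p) (hpos p)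
      (by positivity) h u
    rw [dotProduct_shiftedGram_mulVec] at h2
    have : 0 ≤ c * (u ⬝ᵥ u) :=
      mul_nonneg hc0 (Finset.sum_nonneg fun i _ => mul_self_nonneg (u i))
    linarith
  have hpow : 0 < (Real.exp 1 * L) ^ Q := by positivity
  refine (measureReal_mono hsub).trans ?_
  have hmk := mul_meas_ge_le_integral_of_nonneg (μ := π)
    (f := fun p => trace (shiftedGram c x m p ^ Q)) (ae_of_all _ fun p => ?_)
    (integrable_trace_shiftedGram_pow π hmeas hR c m Q) ((Real.exp 1 * L) ^ Q)
  · have h3 := hmk.trans (integral_trace_shiftedGram_pow_le μ hR0.le hσ0 hmeas hR hadapt hσ Q m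
      le_rfl Q le_rfl)
    have h4 : (Fintype.card ι : ℝ) * L ^ Q =
        (Real.exp 1 * L) ^ Q * (Fintype.card ι * Real.exp (-Q)) := by
      rw [mul_pow, ← Real.exp_nat_mul, mul_one, Real.exp_neg]
      field_simp
    rw [h4] at h3
    exact le_of_mul_le_mul_left h3 hpow
  · obtain ⟨U, l, hU, hU', hSU, hl⟩ := exists_orthogonal_diagonalization (c := 0)
      (shiftedGram_transpose c x m p) (by simpa using hpos p)
    change 0 ≤ trace (shiftedGram c x m p ^ Q)
    rw [hSU, conj_diagonal_pow hU hU', trace_conj hU, diagonal_pow, trace_diagonal]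
    exact Finset.sum_nonneg fun i _ => pow_nonneg (hl i) _

end Moments

section Hermite

open Polynomial

theorem integrable_pow_gaussianReal (n : ℕ) :
    Integrable (fun x : ℝ => x ^ n) (gaussianReal 0 1) := by
  have h := (memLp_id_gaussianReal (μ := 0) (v := 1) n).integrable_norm_pow'
  refine (integrable_norm_iff (by fun_prop)).1 ?_
  simpa [norm_pow] using h

theorem integrable_eval_gaussianReal (P : ℝ[X]) :
    Integrable (fun x : ℝ => P.eval x) (gaussianReal 0 1) := by
  simp only [eval_eq_sum_range]
  exact integrable_finsetSum _ fun i _ => (integrable_pow_gaussianReal i).const_mul _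

theorem integrable_gaussianPDFReal_mul_eval (P : ℝ[X]) :
    Integrable (fun x : ℝ => gaussianPDFReal 0 1 x * P.eval x) := by
  have h := integrable_eval_gaussianReal P
  rw [gaussianReal_of_var_ne_zero _ one_ne_zero, integrable_withDensity_iff_integrable_smul'
    (measurable_gaussianPDF _ _) (ae_of_all _ fun x => gaussianPDF_lt_top)] at h
  simpa [toReal_gaussianPDF] using h

theorem integral_derivative_gaussianReal (P : ℝ[X]) :
    ∫ x, (derivative P).eval x ∂(gaussianReal 0 1) = ∫ x, x * P.eval x ∂(gaussianReal 0 1) := by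
  have hd : ∀ x : ℝ, HasDerivAt (fun x => gaussianPDFReal 0 1 x * P.eval x)
      (gaussianPDFReal 0 1 x * (derivative P - X * P).eval x) x := by
    intro x
    have h1 : HasDerivAt (gaussianPDFReal 0 1) (-x * gaussianPDFReal 0 1 x) x := by
      simp only [gaussianPDFReal_def]
      have : HasDerivAt (fun x : ℝ => -(x - 0) ^ 2 / (2 * ((1 : NNReal) : ℝ))) (-x) x := by
        have := ((((hasDerivAt_id x).sub_const 0).pow 2).neg).div_const (2 * ((1 : NNReal) : ℝ))
        convert! this using 1
        simp
        ring
      convert! this.exp.const_mul (√(2 * Real.pi * ((1 : NNReal) : ℝ)))⁻¹ using 1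
      ring
    convert! h1.mul (P.hasDerivAt x) using 1
    simp
    ring
  have h0 := integral_eq_zero_of_hasDerivAt_of_integrable hd
    (integrable_gaussianPDFReal_mul_eval _) (integrable_gaussianPDFReal_mul_eval _)
  have h1 : ∫ x, (derivative P - X * P).eval x ∂(gaussianReal 0 1) = 0 := by
    rw [integral_gaussianReal_eq_integral_smul one_ne_zero]
    exact h0
  have h2 := integrable_eval_gaussianReal (derivative P)
  have h3 := integrable_eval_gaussianReal (X * P)
  simp only [eval_mul, eval_X] at h3
  simp only [eval_sub, eval_mul, eval_X] at h1
  rw [integral_sub h2 h3] at h1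
  linarith

/-- The `j`-th probabilists' Hermite polynomial with real coefficients. -/
noncomputable def realHermite (j : ℕ) : ℝ[X] := (hermite j).map (Int.castRingHom ℝ)

theorem realHermite_succ (j : ℕ) :
    realHermite (j + 1) = X * realHermite j - derivative (realHermite j) := by
  simp [realHermite, hermite_succ, derivative_map]

theorem aeval_hermite_eq (j : ℕ) (x : ℝ) : aeval x (hermite j) = (realHermite j).eval x := by
  rw [realHermite, eval_map, aeval_def]
  rfl

theorem integral_realHermite_mul (n : ℕ) (P : ℝ[X]) :
    ∫ x, (realHermite n).eval x * P.eval x ∂(gaussianReal 0 1) =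
      ∫ x, (derivative^[n] P).eval x ∂(gaussianReal 0 1) := by
  induction n generalizing P with
  | zero => simp [realHermite]
  | succ n ih =>
    rw [Function.iterate_succ_apply, ← ih (derivative P)]
    have h := integral_derivative_gaussianReal (realHermite n * P)
    have e1 : ∀ x : ℝ, x * (realHermite n * P).eval x =
        (X * realHermite n * P).eval x := fun x => by simp; ring
    simp only [e1, derivative_mul, eval_add] at h
    rw [integral_add (integrable_eval_gaussianReal _) (integrable_eval_gaussianReal _)] at h
    have e2 : ∀ x : ℝ, (realHermite (n + 1)).eval x * P.eval x =
        (X * realHermite n * P).eval x - (derivative (realHermite n) * P).eval x := fun x => by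
      simp [realHermite_succ]; ring
    simp only [e2]
    rw [integral_sub (integrable_eval_gaussianReal _) (integrable_eval_gaussianReal _), ← h]
    simp

theorem natDegree_realHermite (n : ℕ) : (realHermite n).natDegree = n := by
  rw [realHermite, (hermite_monic n).natDegree_map, natDegree_hermite]

theorem integral_realHermite_mul_realHermite (n k : ℕ) :
    ∫ x, (realHermite n).eval x * (realHermite k).eval x ∂(gaussianReal 0 1) =
      if n = k then (n.factorial : ℝ) else 0 := by
  have hlt : ∀ {n k : ℕ}, k < n →
      ∫ x, (realHermite n).eval x * (realHermite k).eval x ∂(gaussianReal 0 1) = 0 := by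
    intro n k h
    rw [integral_realHermite_mul, iterate_derivative_eq_zero (by rwa [natDegree_realHermite])]
    simp
  rcases lt_trichotomy n k with h | h | h
  · rw [if_neg h.ne]
    exact (integral_congr_ae (ae_of_all _ fun x => mul_comm _ _)).trans (hlt h)
  · subst h
    rw [if_pos rfl, integral_realHermite_mul]
    have : derivative^[n] (realHermite n) = C (n.factorial : ℝ) := by
      have hdeg : (derivative^[n] (realHermite n)).natDegree ≤ 0 := by
        refine (natDegree_iterate_derivative _ _).trans ?_
        rw [natDegree_realHermite, Nat.sub_self]
      rw [eq_C_of_natDegree_le_zero hdeg, coeff_iterate_derivative]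
      simp [realHermite, Nat.descFactorial_self]
    rw [this]
    simp
  · rw [if_neg h.ne', hlt h]

theorem normHermite_eq (j : ℕ) (x : ℝ) :
    normHermite j x = (realHermite j).eval x / √(j.factorial : ℝ) := by
  rw [normHermite, aeval_hermite_eq]

@[fun_prop]
theorem continuous_normHermite (j : ℕ) : Continuous (normHermite j) := by
  have : normHermite j = fun x => (realHermite j).eval x / √(j.factorial : ℝ) :=
    funext (normHermite_eq j)
  rw [this]
  exact (realHermite j).continuous.div_const _

theorem integrable_normHermite_mul (i j : ℕ) :
    Integrable (fun x => normHermite i x * normHermite j x) (gaussianReal 0 1) := by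
  have h := (integrable_eval_gaussianReal (realHermite i * realHermite j)).div_const
    (√(i.factorial : ℝ) * √(j.factorial : ℝ))
  refine h.congr (ae_of_all _ fun x => ?_)
  simp only [normHermite_eq, eval_mul]
  rw [div_mul_div_comm]

theorem integral_normHermite_mul (i j : ℕ) :
    ∫ x, normHermite i x * normHermite j x ∂(gaussianReal 0 1) = if i = j then 1 else 0 := by
  simp only [normHermite_eq, div_mul_div_comm]
  rw [integral_div, integral_realHermite_mul_realHermite]
  split_ifs with h
  · subst h
    rw [Real.mul_self_sqrt (by positivity), div_self (by positivity)]
  · simp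

end Hermite

section MultiHermite

variable {n d : ℕ}

instance isProbabilityMeasure_stdNormal (n : ℕ) : IsProbabilityMeasure (stdNormal n) := by
  unfold stdNormal; infer_instance

@[fun_prop]
theorem continuous_multiHermite (I : HermiteIndex n d) : Continuous (multiHermite I) := by
  unfold multiHermite; fun_prop

theorem hermiteIndex_ext {I J : HermiteIndex n d}
    (h : ∀ k, Multiset.count k (I.2 : Multiset (Fin n)) =
      Multiset.count k (J.2 : Multiset (Fin n))) : I = J := by
  obtain ⟨i, s⟩ := I
  obtain ⟨j, t⟩ := J
  have h1 : (s : Multiset (Fin n)) = t := Multiset.ext.2 h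
  have h2 : i = j := by
    have := congrArg Multiset.card h1
    simp at this
    omega
  subst h2
  congr
  exact Sym.coe_injective h1

theorem integrable_multiHermite_mul (I J : HermiteIndex n d) :
    Integrable (fun p => multiHermite I p * multiHermite J p) (stdNormal n) := by
  simp only [multiHermite, ← Finset.prod_mul_distrib]
  exact Integrable.fintype_prod fun k => integrable_normHermite_mul _ _

theorem integral_multiHermite_mul (I J : HermiteIndex n d) :
    ∫ p, multiHermite I p * multiHermite J p ∂(stdNormal n) = if I = J then 1 else 0 := by
  simp only [multiHermite, ← Finset.prod_mul_distrib, stdNormal]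
  rw [integral_fintype_prod_eq_prod (fun k x =>
    normHermite (Multiset.count k (I.2 : Multiset (Fin n))) x *
    normHermite (Multiset.count k (J.2 : Multiset (Fin n))) x)]
  simp only [integral_normHermite_mul]
  split_ifs with h
  · subst h; simp
  · by_contra h0
    refine h (hermiteIndex_ext fun k => ?_)
    have := Finset.prod_ne_zero_iff.1 h0 k (Finset.mem_univ _)
    simpa using this

theorem integrable_sum_multiHermite_sq (v : HermiteIndex n d → ℝ) :
    Integrable (fun p => (∑ I, multiHermite I p * v I) ^ 2) (stdNormal n) := by
  have e : ∀ p : Fin n → ℝ, (∑ I, multiHermite I p * v I) ^ 2 =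
      ∑ I, ∑ J, v I * v J * (multiHermite I p * multiHermite J p) := fun p => by
    rw [sq, Finset.sum_mul_sum]
    exact Finset.sum_congr rfl fun I _ => Finset.sum_congr rfl fun J _ => by ring
  simp only [e]
  exact integrable_finsetSum _ fun I _ => integrable_finsetSum _ fun J _ =>
    (integrable_multiHermite_mul I J).const_mul _

theorem integral_sum_multiHermite_sq (v : HermiteIndex n d → ℝ) :
    ∫ p, (∑ I, multiHermite I p * v I) ^ 2 ∂(stdNormal n) = ∑ I, v I ^ 2 := by
  have e : ∀ p : Fin n → ℝ, (∑ I, multiHermite I p * v I) ^ 2 =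
      ∑ I, ∑ J, v I * v J * (multiHermite I p * multiHermite J p) := fun p => by
    rw [sq, Finset.sum_mul_sum]
    exact Finset.sum_congr rfl fun I _ => Finset.sum_congr rfl fun J _ => by ring
  simp only [e]
  rw [integral_finsetSum _ fun I _ => integrable_finsetSum _ fun J _ =>
    (integrable_multiHermite_mul I J).const_mul _]
  refine Finset.sum_congr rfl fun I _ => ?_
  rw [integral_finsetSum _ fun J _ => (integrable_multiHermite_mul I J).const_mul _]
  simp only [integral_const_mul, integral_multiHermite_mul]
  simp [sq]

theorem interpC_eq_card (n d : ℕ) : interpC n d = Fintype.card (HermiteIndex n d) := by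
  unfold interpC
  simp only [sq]
  rw [integral_finsetSum _ fun I _ => integrable_multiHermite_mul I I]
  simp [integral_multiHermite_mul]

end MultiHermite

section Kernel

open PowerSeries

theorem derivative_realHermite_succ (j : ℕ) :
    Polynomial.derivative (realHermite (j + 1)) = ((j : ℝ) + 1) • realHermite j := by
  induction j with
  | zero => simp [realHermite]
  | succ j ih =>
    rw [realHermite_succ (j + 1), Polynomial.derivative_sub, Polynomial.derivative_mul, ih,
      Polynomial.derivative_X, Polynomial.derivative_smul, realHermite_succ j]
    push_cast
    simp only [Polynomial.smul_eq_C_mul, map_add, map_one, map_natCast]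
    ring

theorem eval_realHermite_add_two (j : ℕ) (x : ℝ) :
    (realHermite (j + 2)).eval x =
      x * (realHermite (j + 1)).eval x - (j + 1) * (realHermite j).eval x := by
  rw [realHermite_succ (j + 1), derivative_realHermite_succ]
  simp

theorem eval_realHermite_zero (x : ℝ) : (realHermite 0).eval x = 1 := by simp [realHermite]

theorem eval_realHermite_one (x : ℝ) : (realHermite 1).eval x = x := by simp [realHermite]

theorem normHermite_mul_normHermite (j : ℕ) (x y : ℝ) : normHermite j x * normHermite j y =
    (realHermite j).eval x * (realHermite j).eval y / j.factorial := by
  rw [normHermite_eq, normHermite_eq, div_mul_div_comm, Real.mul_self_sqrt (by positivity)]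

/-- The generating series `∑ t^j h_j(x) h_j(y)` of Mehler's kernel. -/
noncomputable def mehlerSeries (x y : ℝ) : ℝ⟦X⟧ :=
  PowerSeries.mk fun j => normHermite j x * normHermite j y

/-- The logarithmic derivative of a product of `c` Mehler series is
`(z + b t + z t² - c t³) / (1 - t²)²`. -/
def MehlerODE (z b c : ℝ) (g : ℝ⟦X⟧) : Prop :=
  (1 - X ^ 2) ^ 2 * d⁄dX ℝ g = (C z + C b * X + C z * X ^ 2 - C c * X ^ 3) * g

theorem one_sub_sq_sq_mul_derivative (g : ℝ⟦X⟧) : (1 - X ^ 2) ^ 2 * d⁄dX ℝ g =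
    d⁄dX ℝ g - C 2 * (X ^ 2 * d⁄dX ℝ g) + X ^ 4 * d⁄dX ℝ g := by
  have : (C (2 : ℝ) : ℝ⟦X⟧) = 2 := map_ofNat (C (R := ℝ)) 2
  rw [this]
  ring

theorem mehlerODE_right_eq (z b c : ℝ) (g : ℝ⟦X⟧) :
    (C z + C b * X + C z * X ^ 2 - C c * X ^ 3) * g =
      C z * g + C b * (X ^ 1 * g) + C z * (X ^ 2 * g) - C c * (X ^ 3 * g) := by
  ring

theorem mehlerODE_iff (z b c : ℝ) (g : ℝ⟦X⟧) : MehlerODE z b c g ↔ ∀ k : ℕ,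
    ((k : ℝ) + 1) * coeff (k + 4) (X ^ 3 * g) = z * coeff (k + 3) (X ^ 3 * g) +
      (2 * ((k : ℝ) - 1) + b) * coeff (k + 2) (X ^ 3 * g) +
      z * coeff (k + 1) (X ^ 3 * g) - ((k : ℝ) - 3 + c) * coeff k (X ^ 3 * g) := by
  rw [MehlerODE, one_sub_sq_sq_mul_derivative, mehlerODE_right_eq, PowerSeries.ext_iff]
  refine forall_congr' fun k => ?_
  simp only [map_add, map_sub, coeff_C_mul, coeff_X_pow_mul', coeff_derivative]
  obtain hk | ⟨j, rfl⟩ : k < 4 ∨ ∃ j, k = j + 4 := by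
    rcases lt_or_ge k 4 with h | h
    · exact Or.inl h
    · exact Or.inr ⟨k - 4, by omega⟩
  · interval_cases k <;> norm_num <;> constructor <;> intro h <;> linear_combination h
  · have e1 : j + 4 - 2 = j + 2 := by omega
    have e2 : j + 4 - 4 = j := by omega
    have e3 : j + 4 - 3 = j + 1 := by omega
    have e4 : j + 4 - 1 = j + 3 := by omega
    have e5 : j + 4 + 4 - 3 = j + 5 := by omega
    have e6 : j + 4 + 3 - 3 = j + 4 := by omega
    have e7 : j + 4 + 2 - 3 = j + 3 := by omega
    have e8 : j + 4 + 1 - 3 = j + 2 := by omega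
    have i1 : 2 ≤ j + 4 := by omega
    have i2 : 4 ≤ j + 4 := by omega
    have i3 : 3 ≤ j + 4 := by omega
    have i4 : 1 ≤ j + 4 := by omega
    have i5 : 3 ≤ j + 4 + 4 := by omega
    have i6 : 3 ≤ j + 4 + 3 := by omega
    have i7 : 3 ≤ j + 4 + 2 := by omega
    have i8 : 3 ≤ j + 4 + 1 := by omega
    rw [if_pos i1, if_pos i2, if_pos i4, if_pos i1, if_pos i3, if_pos i5, if_pos i6, if_pos i7,
      if_pos i8, e1, e2, e3, e4, e5, e6, e7, e8]
    push_cast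
    constructor <;> intro h <;> linear_combination h

theorem mehlerODE_mehlerSeries (x y : ℝ) :
    MehlerODE (x * y) (1 - (x ^ 2 + y ^ 2)) 1 (mehlerSeries x y) := by
  rw [mehlerODE_iff]
  intro k
  simp only [coeff_X_pow_mul', mehlerSeries, coeff_mk, normHermite_mul_normHermite]
  rcases k with _ | _ | _ | k
  · norm_num [eval_realHermite_zero, eval_realHermite_one]
  · norm_num [eval_realHermite_zero, eval_realHermite_one, eval_realHermite_add_two 0]
    ring
  · norm_num [eval_realHermite_zero, eval_realHermite_one, eval_realHermite_add_two 0,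
      eval_realHermite_add_two 1, Nat.factorial]
    ring
  · have e5 : k + 1 + 1 + 1 + 4 - 3 = k + 4 := by omega
    have e6 : k + 1 + 1 + 1 + 3 - 3 = k + 3 := by omega
    have e7 : k + 1 + 1 + 1 + 2 - 3 = k + 2 := by omega
    have e8 : k + 1 + 1 + 1 + 1 - 3 = k + 1 := by omega
    have e9 : k + 1 + 1 + 1 - 3 = k := by omega
    have i5 : 3 ≤ k + 1 + 1 + 1 + 4 := by omega
    have i6 : 3 ≤ k + 1 + 1 + 1 + 3 := by omega
    have i7 : 3 ≤ k + 1 + 1 + 1 + 2 := by omega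
    have i8 : 3 ≤ k + 1 + 1 + 1 + 1 := by omega
    have i9 : 3 ≤ k + 1 + 1 + 1 := by omega
    simp only [e5, e6, e7, e8, e9, if_pos i5, if_pos i6, if_pos i7, if_pos i8, if_pos i9,
      eval_realHermite_add_two (k + 2), eval_realHermite_add_two (k + 1),
      eval_realHermite_add_two k, Nat.factorial_succ]
    have hf : (k.factorial : ℝ) ≠ 0 := by positivity
    push_cast
    field_simp
    ring

theorem MehlerODE.one : MehlerODE 0 0 0 1 := by
  rw [MehlerODE]
  simp

theorem MehlerODE.mul {z b c z' b' c' : ℝ} {g g' : ℝ⟦X⟧} (h : MehlerODE z b c g)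
    (h' : MehlerODE z' b' c' g') : MehlerODE (z + z') (b + b') (c + c') (g * g') := by
  unfold MehlerODE at *
  rw [Derivation.leibniz, smul_eq_mul, smul_eq_mul]
  calc _ = g * ((1 - X ^ 2) ^ 2 * d⁄dX ℝ g') + g' * ((1 - X ^ 2) ^ 2 * d⁄dX ℝ g) := by ring
    _ = _ := by
      rw [h, h']
      simp only [map_add]
      ring

theorem MehlerODE.prod {ι : Type*} (t : Finset ι) (z b c : ι → ℝ) (g : ι → ℝ⟦X⟧)
    (h : ∀ i, MehlerODE (z i) (b i) (c i) (g i)) :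
    MehlerODE (∑ i ∈ t, z i) (∑ i ∈ t, b i) (∑ i ∈ t, c i) (∏ i ∈ t, g i) := by
  classical
  induction t using Finset.induction_on with
  | empty => simpa using MehlerODE.one
  | insert i t hi ih =>
    simpa only [Finset.sum_insert hi, Finset.prod_insert hi] using (h i).mul ih

theorem MehlerODE.abs_coeff_le {z b c : ℝ} {g : ℝ⟦X⟧} (h : MehlerODE z b c g)
    (hg : coeff 0 g = 1) {W : ℝ} (hW : 1 ≤ W) (hz : |z| ≤ W) (hs : |b| ≤ 5 * W ^ 2)
    (hc0 : 0 ≤ c) (hc : c ≤ W ^ 2) (k : ℕ) :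
    |coeff k (X ^ 3 * g)| * (4 * W) ^ 3 ≤ (4 * W) ^ k := by
  rw [mehlerODE_iff] at h
  suffices H : ∀ k : ℕ, (∀ j < 4, |coeff (k + j) (X ^ 3 * g)| * (4 * W) ^ 3 ≤ (4 * W) ^ (k + j)) from
    H k 0 (by norm_num)
  intro k
  induction k with
  | zero =>
    intro j hj
    have h4 : (0 : ℝ) ≤ 4 * W := by linarith
    interval_cases j <;> simp [coeff_X_pow_mul', hg] <;> simp_all
  | succ k ih =>
    intro j hj
    by_cases hj3 : j < 3
    · have := ih (j + 1) (by omega)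
      rwa [show k + (j + 1) = k + 1 + j by omega] at this
    · obtain rfl : j = 3 := by omega
      have h0 := ih 0 (by norm_num)
      have h1 := ih 1 (by norm_num)
      have h2 := ih 2 (by norm_num)
      have h3 := ih 3 (by norm_num)
      have hk := h k
      rw [add_zero] at h0
      rw [show k + 1 + 3 = k + 4 by omega]
      set a0 := coeff k (X ^ 3 * g)
      set a1 := coeff (k + 1) (X ^ 3 * g)
      set a2 := coeff (k + 2) (X ^ 3 * g)
      set a3 := coeff (k + 3) (X ^ 3 * g)
      set a4 := coeff (k + 4) (X ^ 3 * g)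
      have hk0 : (0 : ℝ) ≤ k := Nat.cast_nonneg k
      have hW2 : 1 ≤ W ^ 2 := one_le_pow₀ hW
      have hW3 : 0 ≤ (4 * W) ^ 3 := by positivity
      have hWk : 0 ≤ (4 * W) ^ k := by positivity
      have hb : |2 * ((k : ℝ) - 1) + b| ≤ (2 * k + 7) * W ^ 2 := by
        have e1 : |2 * ((k : ℝ) - 1)| ≤ 2 * k + 2 := by
          rw [abs_le]; constructor <;> linarith
        have e2 := abs_add_le (2 * ((k : ℝ) - 1)) b
        nlinarith
      have hc' : |(k : ℝ) - 3 + c| ≤ (k + 4) * W ^ 2 := by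
        rw [abs_le]; constructor <;> nlinarith
      have key : ((k : ℝ) + 1) * |a4| ≤ W * |a3| + (2 * k + 7) * W ^ 2 * |a2| + W * |a1| +
          (k + 4) * W ^ 2 * |a0| := by
        have e : ((k : ℝ) + 1) * |a4| = |((k : ℝ) + 1) * a4| := by
          rw [abs_mul, abs_of_nonneg (by positivity : (0 : ℝ) ≤ k + 1)]
        rw [e, hk]
        refine (abs_sub _ _).trans ?_
        refine add_le_add ((abs_add_le _ _).trans (add_le_add ((abs_add_le _ _).trans
          (add_le_add ?_ ?_)) ?_)) ?_ <;> rw [abs_mul] <;>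
          exact mul_le_mul_of_nonneg_right (by assumption) (abs_nonneg _)
      have hW0 : 0 ≤ W := by linarith
      have t3 : W * (|a3| * (4 * W) ^ 3) ≤ W * (4 * W) ^ (k + 3) :=
        mul_le_mul_of_nonneg_left h3 hW0
      have t2 : (2 * k + 7) * W ^ 2 * (|a2| * (4 * W) ^ 3) ≤ (2 * k + 7) * W ^ 2 * (4 * W) ^ (k + 2) :=
        mul_le_mul_of_nonneg_left h2 (by positivity)
      have t1 : W * (|a1| * (4 * W) ^ 3) ≤ W * (4 * W) ^ (k + 1) :=
        mul_le_mul_of_nonneg_left h1 hW0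
      have t0 : (k + 4) * W ^ 2 * (|a0| * (4 * W) ^ 3) ≤ (k + 4) * W ^ 2 * (4 * W) ^ k :=
        mul_le_mul_of_nonneg_left h0 (by positivity)
      have key2 := mul_le_mul_of_nonneg_right key hW3
      have hkp : (0 : ℝ) < k + 1 := by positivity
      refine le_of_mul_le_mul_left ?_ hkp
      have hW24 : W ^ 2 ≤ W ^ 4 := pow_le_pow_right₀ hW (by norm_num)
      have u1 : W * (4 * W) ^ (k + 1) ≤ (4 * W) ^ k * (4 * W ^ 4) := by
        rw [show W * (4 * W) ^ (k + 1) = (4 * W) ^ k * (4 * W ^ 2) by ring]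
        exact mul_le_mul_of_nonneg_left (by linarith only [hW24]) hWk
      have u0 : (k + 4) * W ^ 2 * (4 * W) ^ k ≤ (4 * W) ^ k * ((k + 4) * W ^ 4) := by
        rw [mul_comm]
        exact mul_le_mul_of_nonneg_left
          (mul_le_mul_of_nonneg_left hW24 (by positivity)) hWk
      have u3 : W * (4 * W) ^ (k + 3) = (4 * W) ^ k * (64 * W ^ 4) := by ring
      have u2 : (2 * k + 7) * W ^ 2 * (4 * W) ^ (k + 2) =
          (4 * W) ^ k * (16 * (2 * k + 7) * W ^ 4) := by ring
      have u4 : ((k : ℝ) + 1) * (4 * W) ^ (k + 4) = (4 * W) ^ k * (256 * (k + 1) * W ^ 4) := by ring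
      have u5 : (4 * W) ^ k * (64 * W ^ 4) + (4 * W) ^ k * (16 * (2 * k + 7) * W ^ 4) +
          (4 * W) ^ k * (4 * W ^ 4) + (4 * W) ^ k * ((k + 4) * W ^ 4) ≤
          (4 * W) ^ k * (256 * (k + 1) * W ^ 4) := by
        rw [← mul_add, ← mul_add, ← mul_add]
        refine mul_le_mul_of_nonneg_left ?_ hWk
        have v1 : 0 ≤ W ^ 4 := by positivity
        have v2 : 0 ≤ (k : ℝ) * W ^ 4 := by positivity
        linarith only [v1, v2]
      rw [u4]
      linarith only [key2, t0, t1, t2, t3, u0, u1, u2, u3, u5]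

end Kernel

section KernelBounds

open PowerSeries

variable {n d : ℕ}

/-- The reproducing kernel `∑_I h_I(p) h_I(q)`. -/
noncomputable def kernel (d : ℕ) (p q : Fin n → ℝ) : ℝ :=
  ∑ I : HermiteIndex n d, multiHermite I p * multiHermite I q

/-- The generating series of the homogeneous parts of the kernel. -/
noncomputable def kernelSeries (p q : Fin n → ℝ) : ℝ⟦X⟧ := ∏ i, mehlerSeries (p i) (q i)

theorem coeff_kernelSeries (p q : Fin n → ℝ) (k : ℕ) : coeff k (kernelSeries p q) =
    ∑ s : Sym (Fin n) k, ∏ i, normHermite (Multiset.count i (s : Multiset (Fin n))) (p i) *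
      normHermite (Multiset.count i (s : Multiset (Fin n))) (q i) := by
  rw [kernelSeries, coeff_prod]
  simp only [mehlerSeries, coeff_mk]
  symm
  refine Finset.sum_bij (fun s _ => (Sym.equivNatSum (Fin n) k s).1) ?_ ?_ ?_ ?_
  · intro s _
    rw [Finset.mem_finsuppAntidiag]
    refine ⟨?_, Finset.subset_univ _⟩
    have := (Sym.equivNatSum (Fin n) k s).2
    rwa [Finsupp.sum_fintype _ _ (fun _ => rfl)] at this
  · intro s _ t _ h
    exact (Sym.equivNatSum (Fin n) k).injective (Subtype.ext h)
  · intro f hf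
    rw [Finset.mem_finsuppAntidiag] at hf
    refine ⟨(Sym.equivNatSum (Fin n) k).symm ⟨f, ?_⟩, Finset.mem_univ _, by simp⟩
    rw [Finsupp.sum_fintype _ _ (fun _ => rfl)]
    exact hf.1
  · intro s _
    rfl

theorem kernel_eq_sum_coeff (p q : Fin n → ℝ) :
    kernel d p q = ∑ k ∈ Finset.range d, coeff (k + 1) (kernelSeries p q) := by
  rw [kernel, Fintype.sum_sigma, Finset.sum_range]
  refine Finset.sum_congr rfl fun k _ => ?_
  rw [coeff_kernelSeries]
  simp only [multiHermite, ← Finset.prod_mul_distrib]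

theorem mehlerODE_kernelSeries (p q : Fin n → ℝ) :
    MehlerODE (p ⬝ᵥ q) (n - (p ⬝ᵥ p + q ⬝ᵥ q)) n (kernelSeries p q) := by
  have h := MehlerODE.prod Finset.univ (fun i => p i * q i) (fun i => 1 - (p i ^ 2 + q i ^ 2))
    (fun _ => 1) _ (fun i => mehlerODE_mehlerSeries (p i) (q i))
  have e : ∑ i, (1 - (p i ^ 2 + q i ^ 2)) = n - (p ⬝ᵥ p + q ⬝ᵥ q) := by
    simp [Finset.sum_add_distrib, dotProduct, sq]
  have e2 : ∑ _i : Fin n, (1 : ℝ) = n := by simp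
  rw [e, e2] at h
  exact h

theorem coeff_zero_kernelSeries (p q : Fin n → ℝ) : coeff 0 (kernelSeries p q) = 1 := by
  rw [coeff_zero_eq_constantCoeff_apply, kernelSeries, map_prod]
  refine Finset.prod_eq_one fun i _ => ?_
  rw [← coeff_zero_eq_constantCoeff_apply, mehlerSeries, coeff_mk, normHermite_mul_normHermite]
  simp [eval_realHermite_zero]

theorem abs_coeff_kernelSeries_le {p q : Fin n → ℝ} {W : ℝ} (hW : 1 ≤ W) (hn : (n : ℝ) ≤ W ^ 2)
    (hpq : |p ⬝ᵥ q| ≤ W) (hp : p ⬝ᵥ p ≤ 2 * n) (hq : q ⬝ᵥ q ≤ 2 * n) (k : ℕ) :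
    |coeff k (kernelSeries p q)| ≤ (4 * W) ^ k := by
  have hp0 : 0 ≤ p ⬝ᵥ p := Finset.sum_nonneg fun i _ => mul_self_nonneg (p i)
  have hq0 : 0 ≤ q ⬝ᵥ q := Finset.sum_nonneg fun i _ => mul_self_nonneg (q i)
  have hn0 : (0 : ℝ) ≤ n := Nat.cast_nonneg n
  have h := (mehlerODE_kernelSeries p q).abs_coeff_le (coeff_zero_kernelSeries p q) hW hpq
    (by rw [abs_le]; constructor <;> nlinarith) hn0 hn (k + 3)
  rw [coeff_X_pow_mul, pow_add] at h
  exact le_of_mul_le_mul_right h (by positivity)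

theorem abs_kernel_le {p q : Fin n → ℝ} {W : ℝ} (hW : 1 ≤ W) (hn : (n : ℝ) ≤ W ^ 2)
    (hpq : |p ⬝ᵥ q| ≤ W) (hp : p ⬝ᵥ p ≤ 2 * n) (hq : q ⬝ᵥ q ≤ 2 * n) :
    |kernel d p q| ≤ d * (4 * W) ^ d := by
  rw [kernel_eq_sum_coeff]
  refine (Finset.abs_sum_le_sum_abs _ _).trans ?_
  refine (Finset.sum_le_card_nsmul _ _ ((4 * W) ^ d) fun k hk => ?_).trans_eq (by simp)
  exact (abs_coeff_kernelSeries_le hW hn hpq hp hq _).trans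
    (pow_le_pow_right₀ (by linarith) (Finset.mem_range.1 hk))

theorem abs_coeff_kernelSeries_self_le {p : Fin n → ℝ} (hn : 1 ≤ n) (hp : p ⬝ᵥ p ≤ 2 * n)
    (k : ℕ) : |coeff k (X ^ 3 * kernelSeries p p)| * (8 * n) ^ 3 ≤ (8 * n : ℝ) ^ k := by
  have hp0 : 0 ≤ p ⬝ᵥ p := Finset.sum_nonneg fun i _ => mul_self_nonneg (p i)
  have hn1 : (1 : ℝ) ≤ n := by exact_mod_cast hn
  have h := (mehlerODE_kernelSeries p p).abs_coeff_le (coeff_zero_kernelSeries p p)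
    (W := 2 * n) (by linarith) (by rwa [abs_of_nonneg hp0])
    (by rw [abs_le]; constructor <;> nlinarith) (by linarith) (by nlinarith) k
  rwa [show (4 * (2 * (n : ℝ))) = 8 * n by ring] at h

theorem abs_coeff_kernelSeries_self_sub_le {p : Fin n → ℝ} (hn : 1 ≤ n) (hp : p ⬝ᵥ p ≤ 2 * n)
    (k : ℕ) : n * |coeff k (kernelSeries p p) - (p ⬝ᵥ p) ^ k / k.factorial| ≤
      k * (8 * n : ℝ) ^ k := by
  have hp0 : 0 ≤ p ⬝ᵥ p := Finset.sum_nonneg fun i _ => mul_self_nonneg (p i)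
  have hn1 : (1 : ℝ) ≤ n := by exact_mod_cast hn
  induction k with
  | zero => simp [coeff_zero_kernelSeries]
  | succ k ih =>
    have hrec := (mehlerODE_iff _ _ _ _).1 (mehlerODE_kernelSeries p p) k
    rw [coeff_X_pow_mul (kernelSeries p p) 3 k, show k + 4 = k + 1 + 3 by omega,
      coeff_X_pow_mul (kernelSeries p p) 3 (k + 1)] at hrec
    have b0 := abs_coeff_kernelSeries_self_le hn hp k
    have b1 := abs_coeff_kernelSeries_self_le hn hp (k + 1)
    have b2 := abs_coeff_kernelSeries_self_le hn hp (k + 2)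
    set z := p ⬝ᵥ p
    set a0 := coeff k (X ^ 3 * kernelSeries p p)
    set a1 := coeff (k + 1) (X ^ 3 * kernelSeries p p)
    set a2 := coeff (k + 2) (X ^ 3 * kernelSeries p p)
    set K0 := coeff k (kernelSeries p p)
    set K1 := coeff (k + 1) (kernelSeries p p)
    set B : ℝ := 8 * n with hB
    have hk0 : (0 : ℝ) ≤ k := Nat.cast_nonneg k
    have hB8 : 8 ≤ B := by linarith
    have hBk : 0 ≤ B ^ k := by positivity
    have c1 : |2 * ((k : ℝ) - 1) + (n - (z + z))| ≤ (2 * k + 6) * n := by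
      rw [abs_le]; constructor <;> nlinarith
    have c0 : |(k : ℝ) - 3 + n| ≤ (k + 4) * n := by
      rw [abs_le]; constructor <;> nlinarith
    have c2 : |z| ≤ 2 * n := by rwa [abs_of_nonneg hp0]
    have key : |(k + 1) * K1 - z * K0| ≤ (2 * k + 6) * n * |a2| + 2 * n * |a1| +
        (k + 4) * n * |a0| := by
      have e : ((k : ℝ) + 1) * K1 - z * K0 = (2 * ((k : ℝ) - 1) + (n - (z + z))) * a2 + z * a1 -
          ((k : ℝ) - 3 + n) * a0 := by linarith only [hrec]
      rw [e]
      refine (abs_sub _ _).trans (add_le_add ((abs_add_le _ _).trans (add_le_add ?_ ?_)) ?_) <;>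
        rw [abs_mul] <;> exact mul_le_mul_of_nonneg_right (by assumption) (abs_nonneg _)
    have hB3 : 0 < B ^ 3 := by positivity
    have key2 : |(k + 1) * K1 - z * K0| ≤ 2 * (k + 1) * B ^ k := by
      refine le_of_mul_le_mul_right ?_ hB3
      refine (mul_le_mul_of_nonneg_right key hB3.le).trans ?_
      have t2 : (2 * k + 6) * n * (|a2| * B ^ 3) ≤ (2 * k + 6) * n * B ^ (k + 2) :=
        mul_le_mul_of_nonneg_left b2 (by positivity)
      have t1 : 2 * n * (|a1| * B ^ 3) ≤ 2 * n * B ^ (k + 1) :=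
        mul_le_mul_of_nonneg_left b1 (by positivity)
      have t0 : (k + 4) * n * (|a0| * B ^ 3) ≤ (k + 4) * n * B ^ k :=
        mul_le_mul_of_nonneg_left b0 (by positivity)
      have hnB : (n : ℝ) = B / 8 := by rw [hB]; ring
      rw [hnB] at t0 t1 t2 ⊢
      have hBB : 0 ≤ B ^ k * B := by positivity
      have s1 : B ^ k * B ≤ B ^ k * B ^ 3 :=
        mul_le_mul_of_nonneg_left (le_self_pow₀ (by linarith) (by norm_num)) hBk
      have s2 : B ^ k * B ^ 2 ≤ B ^ k * B ^ 3 :=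
        mul_le_mul_of_nonneg_left (pow_le_pow_right₀ (by linarith) (by norm_num)) hBk
      have s1' := mul_le_mul_of_nonneg_left s1 hk0
      have s0 : 0 ≤ B ^ k * B ^ 3 := by positivity
      have s0' : 0 ≤ k * (B ^ k * B ^ 3) := by positivity
      have r2 : B ^ (k + 2) = B ^ k * B ^ 2 := pow_add _ _ _
      have r1 : B ^ (k + 1) = B ^ k * B := pow_succ _ _
      have r3 : (2 * k + 6) * (B / 8) * (B ^ k * B ^ 2) = (2 * k + 6) / 8 * (B ^ k * B ^ 3) := by ring
      have r4 : 2 * (B / 8) * (B ^ k * B) = 1 / 4 * (B ^ k * B ^ 2) := by ring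
      rw [r2, r3] at t2
      rw [r1, r4] at t1
      linarith only [t0, t1, t2, s1, s2, s1', s0, s0']
    have hkp : (0 : ℝ) < k + 1 := by positivity
    have key3 : ((k : ℝ) + 1) * |K1 - z ^ (k + 1) / (k + 1).factorial| ≤
        2 * (k + 1) * B ^ k + 2 * n * |K0 - z ^ k / k.factorial| := by
      have e : ((k : ℝ) + 1) * (K1 - z ^ (k + 1) / (k + 1).factorial) =
          ((k + 1) * K1 - z * K0) + z * (K0 - z ^ k / k.factorial) := by
        rw [Nat.factorial_succ]
        push_cast
        have : (k.factorial : ℝ) ≠ 0 := by positivity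
        field_simp
        ring
      rw [← abs_of_pos hkp, ← abs_mul, abs_of_pos hkp, e]
      refine (abs_add_le _ _).trans (add_le_add key2 ?_)
      rw [abs_mul]
      exact mul_le_mul_of_nonneg_right c2 (abs_nonneg _)
    refine le_of_mul_le_mul_left ?_ hkp
    have f1 := mul_le_mul_of_nonneg_left key3 (by positivity : (0 : ℝ) ≤ n)
    have f2 := mul_le_mul_of_nonneg_left ih (by positivity : (0 : ℝ) ≤ 2 * n)
    push_cast
    have hnB : (n : ℝ) = B / 8 := by rw [hB]; ring
    have g1 : 0 ≤ B ^ k * B := by positivity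
    have g2 : 0 ≤ k * (B ^ k * B) := by positivity
    have g3 : 0 ≤ k * (k * (B ^ k * B)) := by positivity
    rw [pow_succ B k]
    rw [hnB] at f1 f2 ⊢
    linarith only [f1, f2, g1, g2, g3]

theorem abs_kernel_self_sub_le {p : Fin n → ℝ} (hd : 1 ≤ d) (hn : 1 ≤ n) (hp : p ⬝ᵥ p ≤ 2 * n) :
    n * |kernel d p p - (p ⬝ᵥ p) ^ d / d.factorial| ≤ 2 * d * 8 ^ d * (n : ℝ) ^ d := by
  have hn1 : (1 : ℝ) ≤ n := by exact_mod_cast hn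
  obtain ⟨e, rfl⟩ : ∃ e, d = e + 1 := ⟨d - 1, by omega⟩
  rw [kernel_eq_sum_coeff, Finset.sum_range_succ]
  have h1 : |∑ k ∈ Finset.range e, coeff (k + 1) (kernelSeries p p)| ≤ e * (8 * n : ℝ) ^ e := by
    refine (Finset.abs_sum_le_sum_abs _ _).trans ?_
    refine (Finset.sum_le_card_nsmul _ _ ((8 * n : ℝ) ^ e) fun k hk => ?_).trans_eq (by simp)
    have h := abs_coeff_kernelSeries_self_le hn hp (k + 1 + 3)
    rw [coeff_X_pow_mul, pow_add] at h
    exact (le_of_mul_le_mul_right h (by positivity)).trans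
      (pow_le_pow_right₀ (by linarith) (Finset.mem_range.1 hk))
  have h2 := abs_coeff_kernelSeries_self_sub_le hn hp (e + 1)
  rw [add_sub_assoc]
  have h3 := mul_le_mul_of_nonneg_left (abs_add_le
    (∑ k ∈ Finset.range e, coeff (k + 1) (kernelSeries p p))
    (coeff (e + 1) (kernelSeries p p) - (p ⬝ᵥ p) ^ (e + 1) / (e + 1).factorial))
    (by positivity : (0 : ℝ) ≤ n)
  have h4 := mul_le_mul_of_nonneg_left h1 (by positivity : (0 : ℝ) ≤ n)
  refine h3.trans ?_
  rw [mul_pow] at h2 h4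
  have e1 : (n : ℝ) * (e * (8 ^ e * n ^ e)) = e * 8 ^ e * n ^ (e + 1) := by ring
  rw [e1] at h4
  rw [mul_add]
  have h5 : 0 ≤ (e : ℝ) * 8 ^ e * n ^ (e + 1) := by positivity
  have h6 : 0 ≤ (8 : ℝ) ^ e * n ^ (e + 1) := by positivity
  push_cast at h2 ⊢
  rw [pow_succ (8 : ℝ) e] at h2 ⊢
  linarith only [h2, h4, h5, h6]

/-- The number of multisets of size `k` is `n ^ k / k!` up to a relative error of order `1 / n`. -/
theorem multichoose_bounds (hn : 1 ≤ n) (k : ℕ) : (n : ℝ) ^ k / k.factorial ≤ n.multichoose k ∧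
    (n.multichoose k : ℝ) ≤ n ^ k ∧
    n * ((n.multichoose k : ℝ) - n ^ k / k.factorial) ≤ k * (n : ℝ) ^ k := by
  have hn1 : (1 : ℝ) ≤ n := by exact_mod_cast hn
  induction k with
  | zero => simp
  | succ k ih =>
    obtain ⟨h1, h2, h3⟩ := ih
    have hrec : ((k : ℝ) + 1) * n.multichoose (k + 1) = (n + k) * n.multichoose k := by
      obtain ⟨a, rfl⟩ : ∃ a, n = a + 1 := ⟨n - 1, by omega⟩
      rw [Nat.multichoose_eq, Nat.multichoose_eq]
      have h4 : a + 1 + (k + 1) - 1 = (a + k) + 1 := by omega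
      have h5 : a + 1 + k - 1 = a + k := by omega
      have h6 : (((a + k + 1) * (a + k).choose k : ℕ) : ℝ) =
        (((a + k + 1).choose (k + 1) * (k + 1) : ℕ) : ℝ) :=
        congrArg _ (Nat.add_one_mul_choose_eq (a + k) k)
      push_cast at h6
      rw [h4, h5]
      push_cast
      linarith only [h6]
    have hk0 : (0 : ℝ) ≤ k := Nat.cast_nonneg k
    have hkp : (0 : ℝ) < k + 1 := by positivity
    set N0 : ℝ := (n.multichoose k : ℝ)
    set N1 : ℝ := (n.multichoose (k + 1) : ℝ)
    have hf : (n : ℝ) ^ (k + 1) / (k + 1).factorial = n * (n ^ k / k.factorial) / (k + 1) := by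
      rw [Nat.factorial_succ]
      push_cast
      have : (k.factorial : ℝ) ≠ 0 := by positivity
      field_simp
      ring
    rw [hf]
    set F : ℝ := n ^ k / k.factorial
    have hF : 0 ≤ F := by positivity
    have hN0 : 0 ≤ N0 := hF.trans h1
    have hN1 : N1 = (n + k) * N0 / (k + 1) := by
      rw [eq_div_iff hkp.ne']
      linarith only [hrec]
    refine ⟨?_, ?_, ?_⟩
    · rw [hN1]
      gcongr
      linarith
    · rw [hN1, div_le_iff₀ hkp]
      have : (n + k) * N0 ≤ n * (k + 1) * N0 :=
        mul_le_mul_of_nonneg_right (by nlinarith) hN0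
      refine this.trans ?_
      rw [pow_succ]
      have := mul_le_mul_of_nonneg_left h2 (by positivity : (0 : ℝ) ≤ n * (k + 1))
      linarith only [this]
    · rw [hN1, ← sub_div, ← mul_div_assoc, div_le_iff₀ hkp]
      have e : (n : ℝ) * ((n + k) * N0 - n * F) = n * (n * (N0 - F)) + n * k * N0 := by ring
      rw [e]
      have g1 := mul_le_mul_of_nonneg_left h3 (by positivity : (0 : ℝ) ≤ n)
      have g2 := mul_le_mul_of_nonneg_left h2 (by positivity : (0 : ℝ) ≤ n * k)
      have g3 : 0 ≤ (n : ℝ) ^ k * n := by positivity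
      have g4 : 0 ≤ k * ((n : ℝ) ^ k * n) := by positivity
      have g5 : 0 ≤ k * (k * ((n : ℝ) ^ k * n)) := by positivity
      rw [pow_succ]
      push_cast
      linarith only [g1, g2, g3, g4, g5]

theorem card_hermiteIndex (n d : ℕ) :
    Fintype.card (HermiteIndex n d) = ∑ k ∈ Finset.range d, n.multichoose (k + 1) := by
  rw [Fintype.card_sigma, Finset.sum_range]
  refine Finset.sum_congr rfl fun k _ => ?_
  rw [Sym.card_sym_eq_multichoose, Fintype.card_fin]

theorem card_hermiteIndex_bounds (hd : 1 ≤ d) (hn : 1 ≤ n) :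
    (n : ℝ) ^ d / d.factorial ≤ Fintype.card (HermiteIndex n d) ∧
    (Fintype.card (HermiteIndex n d) : ℝ) ≤ d * n ^ d ∧
    n * ((Fintype.card (HermiteIndex n d) : ℝ) - n ^ d / d.factorial) ≤ 2 * d * (n : ℝ) ^ d := by
  have hn1 : (1 : ℝ) ≤ n := by exact_mod_cast hn
  obtain ⟨e, rfl⟩ : ∃ e, d = e + 1 := ⟨d - 1, by omega⟩
  rw [card_hermiteIndex, Finset.sum_range_succ]
  push_cast
  have h1 : ∑ k ∈ Finset.range e, (n.multichoose (k + 1) : ℝ) ≤ e * n ^ e := by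
    refine (Finset.sum_le_card_nsmul _ _ ((n : ℝ) ^ e) fun k hk => ?_).trans_eq (by simp)
    exact (multichoose_bounds hn (k + 1)).2.1.trans
      (pow_le_pow_right₀ hn1 (Finset.mem_range.1 hk))
  have h0 : 0 ≤ ∑ k ∈ Finset.range e, (n.multichoose (k + 1) : ℝ) := by positivity
  obtain ⟨b1, b2, b3⟩ := multichoose_bounds hn (e + 1)
  refine ⟨by linarith, ?_, ?_⟩
  · have : (n : ℝ) ^ e ≤ n ^ (e + 1) := pow_le_pow_right₀ hn1 (by omega)
    have := mul_le_mul_of_nonneg_left this (Nat.cast_nonneg (α := ℝ) e)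
    linarith
  · have g1 := mul_le_mul_of_nonneg_left h1 (by positivity : (0 : ℝ) ≤ n)
    have g2 : 0 ≤ (n : ℝ) ^ e * n := by positivity
    rw [pow_succ] at *
    push_cast at b3
    linarith only [g1, g2, b3]

/-- The diagonal of the kernel concentrates when the norm of the point does. -/
theorem exists_abs_kernel_self_div_card_sub_one_le (hd : 1 ≤ d) : ∃ c : ℝ, 0 ≤ c ∧
    ∀ n : ℕ, 1 ≤ n → ∀ ε : ℝ, ε ≤ 1 → ∀ p : Fin n → ℝ, |p ⬝ᵥ p - n| ≤ ε * n →
      |kernel d p p / Fintype.card (HermiteIndex n d) - 1| ≤ c * (ε + 1 / n) := by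
  refine ⟨d.factorial * (2 * d * 8 ^ d + 2 * d + d * 2 ^ d), by positivity, ?_⟩
  intro n hn ε hε p hp
  have hn1 : (1 : ℝ) ≤ n := by exact_mod_cast hn
  have hn0 : (0 : ℝ) < n := by linarith
  have hε0 : 0 ≤ ε := by
    by_contra! h
    have := abs_nonneg (p ⬝ᵥ p - n)
    nlinarith
  have hp2 : p ⬝ᵥ p ≤ 2 * n := by
    have := (abs_le.1 hp).2
    nlinarith
  have hp0 : 0 ≤ p ⬝ᵥ p := Finset.sum_nonneg fun i _ => mul_self_nonneg (p i)
  obtain ⟨b1, b2, b3⟩ := card_hermiteIndex_bounds (d := d) hd hn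
  have hk := abs_kernel_self_sub_le hd hn hp2
  set N : ℝ := (Fintype.card (HermiteIndex n d) : ℝ)
  set z := p ⬝ᵥ p
  have hf : (0 : ℝ) < d.factorial := by positivity
  have hf1 : (1 : ℝ) ≤ d.factorial := by exact_mod_cast Nat.one_le_iff_ne_zero.2 (Nat.factorial_ne_zero d)
  have hNpos : 0 < N := lt_of_lt_of_le (by positivity) b1
  have hpow : |z ^ d - n ^ d| ≤ d * 2 ^ d * (n : ℝ) ^ d * ε := by
    have h := abs_pow_sub_pow_le z (n : ℝ) d
    refine h.trans ?_
    have hm : max |z| |(n : ℝ)| ≤ 2 * n :=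
      max_le (by rwa [abs_of_nonneg hp0]) (by rw [abs_of_pos hn0]; linarith)
    have hm' := pow_le_pow_left₀ (le_max_of_le_left (abs_nonneg z)) hm (d - 1)
    obtain ⟨e, rfl⟩ : ∃ e, d = e + 1 := ⟨d - 1, by omega⟩
    rw [Nat.add_sub_cancel] at hm' ⊢
    calc |z - n| * ((e + 1 : ℕ) : ℝ) * max |z| |(n : ℝ)| ^ e
        ≤ (ε * n) * ((e + 1 : ℕ) : ℝ) * (2 * n) ^ e := by gcongr
      _ ≤ 2 * ((ε * n) * ((e + 1 : ℕ) : ℝ) * (2 * n) ^ e) :=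
          le_mul_of_one_le_left (by positivity) (by norm_num)
      _ = _ := by rw [mul_pow]; ring
  have h1 : |kernel d p p - z ^ d / d.factorial| ≤ 2 * d * 8 ^ d * (n : ℝ) ^ d * (1 / n) := by
    rw [mul_one_div, le_div_iff₀ hn0]
    linarith
  have h2 : |z ^ d / d.factorial - n ^ d / d.factorial| ≤ d * 2 ^ d * (n : ℝ) ^ d * ε := by
    rw [← sub_div, abs_div, abs_of_pos hf]
    exact (div_le_self (abs_nonneg _) hf1).trans hpow
  have h3 : |n ^ d / d.factorial - N| ≤ 2 * d * (n : ℝ) ^ d * (1 / n) := by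
    rw [abs_sub_comm, abs_of_nonneg (by linarith), mul_one_div, le_div_iff₀ hn0]
    linarith
  have h4 : |kernel d p p - N| ≤ (2 * d * 8 ^ d + 2 * d + d * 2 ^ d) * (n : ℝ) ^ d * (ε + 1 / n) := by
    have e : kernel d p p - N = (kernel d p p - z ^ d / d.factorial) +
      (z ^ d / d.factorial - n ^ d / d.factorial) + (n ^ d / d.factorial - N) := by ring
    rw [e]
    refine ((abs_add_le _ _).trans (add_le_add (abs_add_le _ _) le_rfl)).trans ?_
    have g1 : 0 ≤ (2 * d * 8 ^ d + 2 * d) * (n : ℝ) ^ d * ε := by positivity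
    have g2 : 0 ≤ d * 2 ^ d * (n : ℝ) ^ d * (1 / n) := by positivity
    linarith only [h1, h2, h3, g1, g2]
  rw [div_sub_one hNpos.ne', abs_div, abs_of_pos hNpos, div_le_iff₀ hNpos]
  refine h4.trans ?_
  have h5 : (n : ℝ) ^ d ≤ d.factorial * N := by
    rw [div_le_iff₀ hf] at b1
    linarith
  have := mul_le_mul_of_nonneg_left h5
    (by positivity : 0 ≤ (2 * d * 8 ^ d + 2 * d + d * 2 ^ d : ℝ) * (ε + 1 / n))
  linarith only [this]

end KernelBounds

section Tails

variable {n : ℕ}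

theorem gaussianPDFReal_mul_exp_sq (t x : ℝ) : gaussianPDFReal 0 1 x * Real.exp (t * x ^ 2) =
    (√(2 * Real.pi))⁻¹ * Real.exp (-(1 / 2 - t) * x ^ 2) := by
  rw [gaussianPDFReal_def, mul_assoc, ← Real.exp_add]
  simp only [NNReal.coe_one, mul_one, sub_zero]
  congr 2
  ring

theorem integrable_exp_mul_sq_gaussianReal {t : ℝ} (ht : t < 1 / 2) :
    Integrable (fun x : ℝ => Real.exp (t * x ^ 2)) (gaussianReal 0 1) := by
  rw [gaussianReal_of_var_ne_zero _ one_ne_zero, integrable_withDensity_iff_integrable_smul'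
    (measurable_gaussianPDF _ _) (ae_of_all _ fun x => gaussianPDF_lt_top)]
  simp only [toReal_gaussianPDF, smul_eq_mul, gaussianPDFReal_mul_exp_sq]
  exact (integrable_exp_neg_mul_sq (by linarith)).const_mul _

theorem integral_exp_mul_sq_gaussianReal_le {t : ℝ} (ht : |t| ≤ 1 / 4) :
    ∫ x, Real.exp (t * x ^ 2) ∂(gaussianReal 0 1) ≤ Real.exp (t + 4 * t ^ 2) := by
  obtain ⟨h1, h2⟩ := abs_le.1 ht
  rw [integral_gaussianReal_eq_integral_smul one_ne_zero]
  simp only [smul_eq_mul, gaussianPDFReal_mul_exp_sq]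
  rw [integral_const_mul, integral_gaussian, ← Real.sqrt_inv, ← Real.sqrt_mul (by positivity)]
  refine Real.sqrt_le_iff.2 ⟨(Real.exp_pos _).le, ?_⟩
  have hpos : 0 < 1 - 2 * t := by linarith
  have e : (2 * Real.pi)⁻¹ * (Real.pi / (1 / 2 - t)) = 1 / (1 - 2 * t) := by
    have : (1 / 2 - t) ≠ 0 := by intro h; linarith
    have := Real.pi_ne_zero
    field_simp
  rw [e, ← Real.exp_nat_mul]
  have h3 := Real.add_one_le_exp (2 * t / (1 - 2 * t))
  have h4 : 2 * t / (1 - 2 * t) + 1 = 1 / (1 - 2 * t) := by field_simp; ring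
  rw [h4] at h3
  refine h3.trans (Real.exp_le_exp.2 ?_)
  rw [div_le_iff₀ hpos]
  push_cast
  nlinarith [mul_nonneg (sq_nonneg t) (by linarith : 0 ≤ 1 - 4 * t)]

theorem exp_mul_dotProduct_self (t : ℝ) (p : Fin n → ℝ) :
    Real.exp (t * (p ⬝ᵥ p)) = ∏ i, Real.exp (t * p i ^ 2) := by
  rw [← Real.exp_sum, dotProduct, Finset.mul_sum]
  simp only [sq]

theorem measureReal_abs_dotProduct_self_sub_le {ε : ℝ} (hε0 : 0 ≤ ε) (hε1 : ε ≤ 1) :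
    (stdNormal n).real {p | ε * n < |p ⬝ᵥ p - n|} ≤ 2 * Real.exp (-(n * ε ^ 2 / 16)) := by
  have hint : ∀ t : ℝ, |t| ≤ 1 / 4 →
      Integrable (fun p : Fin n → ℝ => Real.exp (t * (p ⬝ᵥ p))) (stdNormal n) := by
    intro t ht
    simp only [exp_mul_dotProduct_self]
    exact Integrable.fintype_prod (f := fun _ x => Real.exp (t * x ^ 2)) fun k =>
      integrable_exp_mul_sq_gaussianReal (by linarith [(abs_le.1 ht).2])
  have hmgf : ∀ t : ℝ, |t| ≤ 1 / 4 →
      mgf (fun p : Fin n → ℝ => p ⬝ᵥ p) (stdNormal n) t ≤ Real.exp (n * (t + 4 * t ^ 2)) := by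
    intro t ht
    simp only [mgf, exp_mul_dotProduct_self, stdNormal]
    rw [integral_fintype_prod_eq_prod (fun _ x => Real.exp (t * x ^ 2)), Finset.prod_const,
      Finset.card_univ, Fintype.card_fin, Real.exp_nat_mul]
    exact pow_le_pow_left₀ (integral_nonneg fun x => (Real.exp_pos _).le)
      (integral_exp_mul_sq_gaussianReal_le ht) _
  have hup := measure_ge_le_exp_mul_mgf (μ := stdNormal n) (X := fun p : Fin n → ℝ => p ⬝ᵥ p)
    (t := ε / 8) (n * (1 + ε)) (by positivity)
    (hint _ (by rw [abs_le]; constructor <;> linarith))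
  have hlo := measure_le_le_exp_mul_mgf (μ := stdNormal n) (X := fun p : Fin n → ℝ => p ⬝ᵥ p)
    (t := -(ε / 8)) (n * (1 - ε)) (by linarith)
    (hint _ (by rw [abs_le]; constructor <;> linarith))
  have hup2 := hup.trans (mul_le_mul_of_nonneg_left (hmgf (ε / 8)
    (by rw [abs_le]; constructor <;> linarith)) (Real.exp_pos _).le)
  have hlo2 := hlo.trans (mul_le_mul_of_nonneg_left (hmgf (-(ε / 8))
    (by rw [abs_le]; constructor <;> linarith)) (Real.exp_pos _).le)
  rw [← Real.exp_add] at hup2 hlo2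
  have hsub : {p : Fin n → ℝ | ε * n < |p ⬝ᵥ p - n|} ⊆
      {p | n * (1 + ε) ≤ p ⬝ᵥ p} ∪ {p | p ⬝ᵥ p ≤ n * (1 - ε)} := by
    intro p hp
    have hp' : ε * n < |p ⬝ᵥ p - n| := hp
    rcases lt_abs.1 hp' with h | h
    · left; change n * (1 + ε) ≤ p ⬝ᵥ p; linarith
    · right; change p ⬝ᵥ p ≤ n * (1 - ε); linarith
  refine (measureReal_mono hsub).trans ((measureReal_union_le _ _).trans ?_)
  rw [two_mul]
  refine add_le_add (hup2.trans_eq ?_) (hlo2.trans_eq ?_) <;> congr 1 <;> ring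

theorem measureReal_dotProduct_ge_le {a : Fin n → ℝ} {V u : ℝ} (hV : 0 < V) (ha : a ⬝ᵥ a ≤ V)
    (hu : 0 ≤ u) : (stdNormal n).real {q | u ≤ a ⬝ᵥ q} ≤ Real.exp (-(u ^ 2 / (2 * V))) := by
  have hexp : ∀ (t : ℝ) (q : Fin n → ℝ), Real.exp (t * (a ⬝ᵥ q)) =
      ∏ i, Real.exp (t * a i * q i) := fun t q => by
    rw [← Real.exp_sum, dotProduct, Finset.mul_sum]
    simp only [mul_assoc]
  have hint : Integrable (fun q : Fin n → ℝ => Real.exp (u / V * (a ⬝ᵥ q))) (stdNormal n) := by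
    simp only [hexp]
    exact Integrable.fintype_prod (f := fun i x => Real.exp (u / V * a i * x)) fun k =>
      integrable_exp_mul_gaussianReal _
  have h := measure_ge_le_exp_mul_mgf (μ := stdNormal n) (X := fun q : Fin n → ℝ => a ⬝ᵥ q)
    (t := u / V) u (by positivity) hint
  refine h.trans ?_
  have hm : mgf (fun q : Fin n → ℝ => a ⬝ᵥ q) (stdNormal n) (u / V) =
      Real.exp ((u / V) ^ 2 * (a ⬝ᵥ a) / 2) := by
    simp only [mgf, hexp, stdNormal]
    rw [integral_fintype_prod_eq_prod (fun i x => Real.exp (u / V * a i * x))]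
    have h1 : ∀ t : ℝ, ∫ x, Real.exp (t * x) ∂(gaussianReal 0 1) = Real.exp (t ^ 2 / 2) := by
      intro t
      have := congrFun (mgf_fun_id_gaussianReal (μ := 0) (v := 1)) t
      simpa [mgf] using this
    simp only [h1]
    rw [← Real.exp_sum, dotProduct, Finset.mul_sum, Finset.sum_div]
    congr 1
    exact Finset.sum_congr rfl fun i _ => by ring
  rw [hm, ← Real.exp_add]
  refine Real.exp_le_exp.2 ?_
  have h2 : (u / V) ^ 2 * (a ⬝ᵥ a) / 2 ≤ (u / V) ^ 2 * V / 2 := by gcongr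
  have h3 : (u / V) ^ 2 * V / 2 = u ^ 2 / (2 * V) := by field_simp
  have h4 : u / V * u = 2 * (u ^ 2 / (2 * V)) := by field_simp
  linarith

theorem measureReal_abs_dotProduct_gt_le {a : Fin n → ℝ} {V u : ℝ} (hV : 0 < V) (ha : a ⬝ᵥ a ≤ V)
    (hu : 0 ≤ u) :
    (stdNormal n).real {q | u < |a ⬝ᵥ q|} ≤ 2 * Real.exp (-(u ^ 2 / (2 * V))) := by
  have hsub : {q : Fin n → ℝ | u < |a ⬝ᵥ q|} ⊆ {q | u ≤ a ⬝ᵥ q} ∪ {q | u ≤ (-a) ⬝ᵥ q} := by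
    intro q hq
    have hq' : u < |a ⬝ᵥ q| := hq
    rcases lt_abs.1 hq' with h | h
    · left; exact h.le
    · right; change u ≤ (-a) ⬝ᵥ q; rw [neg_dotProduct]; exact h.le
  refine (measureReal_mono hsub).trans ((measureReal_union_le _ _).trans ?_)
  rw [two_mul]
  exact add_le_add (measureReal_dotProduct_ge_le hV ha hu)
    (measureReal_dotProduct_ge_le hV (by simpa using ha) hu)

end Tails

section IsotropicGram

open Matrix

variable {X : Type*} [MeasurableSpace X] (μ : Measure X) [IsProbabilityMeasure μ]
  {ι : Type*} [Fintype ι] [DecidableEq ι] {m : ℕ}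

theorem zero_le_dotProduct_self {κ : Type*} [Fintype κ] (v : κ → ℝ) : 0 ≤ v ⬝ᵥ v :=
  Finset.sum_nonneg fun i _ => mul_self_nonneg (v i)

/-- The `k`-th vector of a sample, replaced by `0` when its squared norm exceeds `R`. -/
noncomputable def truncVec (A : X → ι → ℝ) (R : ℝ) (k : ℕ) (p : Fin m → X) : ι → ℝ :=
  if h : k < m then (if A (p ⟨k, h⟩) ⬝ᵥ A (p ⟨k, h⟩) ≤ R then A (p ⟨k, h⟩) else 0) else 0

/-- The strictly upper triangular part of the `k`-th column of the Gram matrix of a sample. -/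
noncomputable def upperCol (A : X → ι → ℝ) (k : Fin m) (p : Fin m → X) : Fin m → ℝ :=
  fun j => if j < k then A (p j) ⬝ᵥ A (p k) else 0

/-- The Gram matrix of the first `k` vectors of the sample has norm at most `σ`. -/
def PrefixBound (A : X → ι → ℝ) (σ : ℝ) (k : Fin m) (p : Fin m → X) : Prop :=
  ∀ u : Fin m → ℝ, (∑ j, (if j < k then u j else 0) • A (p j)) ⬝ᵥ
    (∑ j, (if j < k then u j else 0) • A (p j)) ≤ σ * (u ⬝ᵥ u)

open Classical in
/-- `upperCol`, replaced by `0` when it or the preceding Gram matrix is too large. -/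
noncomputable def truncUpperCol (A : X → ι → ℝ) (R σ : ℝ) (k : ℕ) (p : Fin m → X) : Fin m → ℝ :=
  if h : k < m then (if upperCol A ⟨k, h⟩ p ⬝ᵥ upperCol A ⟨k, h⟩ p ≤ R ∧ PrefixBound A σ ⟨k, h⟩ p
    then upperCol A ⟨k, h⟩ p else 0) else 0

omit [DecidableEq ι] in
theorem measurable_dotProduct {α : Type*} [MeasurableSpace α] {f g : α → ι → ℝ}
    (hf : Measurable f) (hg : Measurable g) : Measurable fun a => f a ⬝ᵥ g a :=
  Finset.measurable_sum _ fun i _ =>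
    ((measurable_pi_apply i).comp hf).mul ((measurable_pi_apply i).comp hg)

omit [DecidableEq ι] in
theorem measurable_truncVec {A : X → ι → ℝ} (hA : Measurable A) (R : ℝ) (k : ℕ) :
    Measurable (truncVec (m := m) A R k) := by
  unfold truncVec
  by_cases h : k < m
  · simp only [h, dite_true]
    have h1 : Measurable fun p : Fin m → X => A (p ⟨k, h⟩) := hA.comp (measurable_pi_apply _)
    exact Measurable.ite (measurableSet_le (measurable_dotProduct h1 h1) measurable_const) h1
      measurable_const
  · simp only [h, dite_false]
    exact measurable_const

omit [DecidableEq ι] in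
theorem measurableSet_prefixBound {A : X → ι → ℝ} (hA : Measurable A) (σ : ℝ) (k : Fin m) :
    MeasurableSet {p : Fin m → X | PrefixBound A σ k p} := by
  have hcl : IsClosed {a : Fin m → ι → ℝ | ∀ u : Fin m → ℝ,
      (∑ j, (if j < k then u j else 0) • a j) ⬝ᵥ (∑ j, (if j < k then u j else 0) • a j) ≤
        σ * (u ⬝ᵥ u)} := by
    rw [Set.ofPred_forall]
    exact isClosed_iInter fun u => isClosed_le (by fun_prop) (by fun_prop)
  have hm : Measurable fun (p : Fin m → X) (j : Fin m) => A (p j) :=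
    measurable_pi_iff.2 fun j => hA.comp (measurable_pi_apply j)
  exact hm hcl.measurableSet

omit [DecidableEq ι] in
theorem measurable_truncUpperCol {A : X → ι → ℝ} (hA : Measurable A) (R σ : ℝ) (k : ℕ) :
    Measurable (truncUpperCol (m := m) A R σ k) := by
  unfold truncUpperCol
  by_cases h : k < m
  · simp only [h, dite_true]
    have h1 : Measurable fun p : Fin m → X => upperCol A ⟨k, h⟩ p := by
      refine measurable_pi_iff.2 fun j => ?_
      unfold upperCol
      by_cases hj : j < ⟨k, h⟩
      · simp only [hj, if_true]
        exact measurable_dotProduct (hA.comp (measurable_pi_apply _))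
          (hA.comp (measurable_pi_apply _))
      · simp only [hj, if_false]
        exact measurable_const
    exact Measurable.ite ((measurableSet_le (measurable_dotProduct h1 h1) measurable_const).inter
      (measurableSet_prefixBound hA σ _)) h1 measurable_const
  · simp only [h, dite_false]
    exact measurable_const

omit [DecidableEq ι] in
theorem dotProduct_sum_smul_self_le {A : Fin m → ι → ℝ} {σ : ℝ} (hσ : 0 ≤ σ)
    (h : ∀ v : ι → ℝ, ∑ j, (A j ⬝ᵥ v) ^ 2 ≤ σ * (v ⬝ᵥ v)) (u : Fin m → ℝ) :
    (∑ j, u j • A j) ⬝ᵥ (∑ j, u j • A j) ≤ σ * (u ⬝ᵥ u) := by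
  set w := ∑ j, u j • A j with hw
  have e : w ⬝ᵥ w = ∑ j, u j * (A j ⬝ᵥ w) := by
    nth_rewrite 1 [hw]
    rw [sum_dotProduct]
    simp
  have hcs : (w ⬝ᵥ w) ^ 2 ≤ (∑ j, u j ^ 2) * ∑ j, (A j ⬝ᵥ w) ^ 2 := by
    rw [e]
    exact Finset.sum_mul_sq_le_sq_mul_sq _ _ _
  have hu : ∑ j, u j ^ 2 = u ⬝ᵥ u := Finset.sum_congr rfl fun j _ => sq _
  rw [hu] at hcs
  have hw0 := zero_le_dotProduct_self w
  have hu0 := zero_le_dotProduct_self u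
  rcases hw0.eq_or_lt with h0 | h0
  · rw [← h0]; positivity
  · refine le_of_mul_le_mul_right ?_ h0
    have := mul_le_mul_of_nonneg_left (h w) hu0
    nlinarith

theorem measureReal_upperCol_le {A : X → ι → ℝ} (hA : Measurable A)
    (hint : ∀ v, Integrable (fun x => (A x ⬝ᵥ v) ^ 2) μ)
    (hiso : ∀ v, ∫ x, (A x ⬝ᵥ v) ^ 2 ∂μ = v ⬝ᵥ v) {R κ : ℝ} (hR : 0 < R) (hκ : 0 < κ)
    {Q : ℕ} (hQ : 0 < Q) :
    (Measure.pi fun _ : Fin m => μ).real {p | (∀ i, A (p i) ⬝ᵥ A (p i) ≤ R) ∧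
      (∀ i j, i < j → (A (p i) ⬝ᵥ A (p j)) ^ 2 ≤ κ) ∧ ∃ u : Fin m → ℝ,
      Real.exp 1 * (Q * (m * κ) +
        Real.exp 1 * (Real.exp 1 * (Q * R + Real.exp 1 * 1 * m)) * m) * (u ⬝ᵥ u) <
        ∑ k, (upperCol A k p ⬝ᵥ u) ^ 2} ≤ (Fintype.card ι + m) * Real.exp (-Q) := by
  rcases Nat.eq_zero_or_pos m with rfl | hm
  · refine (measureReal_mono (s₂ := ∅) ?_).trans ?_
    · rintro p ⟨_, _, u, hu⟩
      simp [dotProduct] at hu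
    · simp; positivity
  have hm0 : (0 : ℝ) < m := by exact_mod_cast hm
  set σ := Real.exp 1 * (Q * R + Real.exp 1 * 1 * m) with hσdef
  have hσ0 : 0 ≤ σ := by positivity
  have b1 := measureReal_exists_lt_sum_sq_le (m := m) μ (x := truncVec A R) hR zero_le_one
    (measurable_truncVec hA R) (fun k p => by
      unfold truncVec
      split_ifs with h1 h2
      · exact h2
      · simpa using hR.le
      · simpa using hR.le)
    (fun k j hjk p ω => by
      unfold truncVec
      have hj : j < m := hjk.trans k.2
      have : Function.update p k ω ⟨j, hj⟩ = p ⟨j, hj⟩ :=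
        Function.update_of_ne (fun h => hjk.ne (congrArg Fin.val h)) _ _
      simp only [hj, dite_true, this])
    (fun k p u => by
      have e : ∀ ω, truncVec A R k (Function.update p k ω) =
          if A ω ⬝ᵥ A ω ≤ R then A ω else 0 := fun ω => by
        simp [truncVec]
      simp only [e, one_mul, ← hiso u]
      refine integral_mono_of_nonneg (ae_of_all _ fun ω => sq_nonneg _) (hint u)
        (ae_of_all _ fun ω => ?_)
      change (_ ⬝ᵥ u) ^ 2 ≤ (A ω ⬝ᵥ u) ^ 2
      split_ifs
      · exact le_rfl
      · simpa using sq_nonneg _) hQ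
  have b2 := measureReal_exists_lt_sum_sq_le (m := m) μ (x := truncUpperCol A (m * κ) σ) (R := m * κ)
    (by positivity) hσ0 (measurable_truncUpperCol hA _ _) (fun k p => by
      unfold truncUpperCol
      split_ifs with h1 h2
      · exact h2.1
      · simpa using (by positivity)
      · simpa using (by positivity))
    (fun k j hjk p ω => by
      have hj : j < m := hjk.trans k.2
      have hup : ∀ i : Fin m, i ≤ ⟨j, hj⟩ → Function.update p k ω i = p i := fun i hi =>
        Function.update_of_ne (fun h => by
          rw [h] at hi
          exact absurd hi (not_le.2 hjk)) _ _
      have e1 : upperCol A ⟨j, hj⟩ (Function.update p k ω) = upperCol A ⟨j, hj⟩ p := by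
        funext i
        unfold upperCol
        split_ifs with hi
        · rw [hup i hi.le, hup _ le_rfl]
        · rfl
      have e2 : PrefixBound A σ ⟨j, hj⟩ (Function.update p k ω) ↔ PrefixBound A σ ⟨j, hj⟩ p := by
        unfold PrefixBound
        refine forall_congr' fun u => ?_
        have : ∀ i : Fin m, (if i < ⟨j, hj⟩ then u i else 0) • A (Function.update p k ω i) =
            (if i < ⟨j, hj⟩ then u i else 0) • A (p i) := fun i => by
          split_ifs with hi
          · rw [hup i hi.le]
          · simp
        simp only [this]
      simp only [truncUpperCol, hj, dite_true]
      have e3 : (upperCol A ⟨j, hj⟩ (Function.update p k ω) ⬝ᵥ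
          upperCol A ⟨j, hj⟩ (Function.update p k ω) ≤ m * κ ∧
          PrefixBound A σ ⟨j, hj⟩ (Function.update p k ω)) ↔
          (upperCol A ⟨j, hj⟩ p ⬝ᵥ upperCol A ⟨j, hj⟩ p ≤ m * κ ∧ PrefixBound A σ ⟨j, hj⟩ p) := by
        rw [e1, e2]
      by_cases hb : upperCol A ⟨j, hj⟩ p ⬝ᵥ upperCol A ⟨j, hj⟩ p ≤ m * κ ∧ PrefixBound A σ ⟨j, hj⟩ p
      · rw [if_pos hb, if_pos (e3.2 hb), e1]
      · rw [if_neg hb, if_neg (mt e3.1 hb)])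
    (fun k p u => by
      have hup : ∀ i : Fin m, i < k → ∀ ω, Function.update p k ω i = p i := fun i hi ω =>
        Function.update_of_ne hi.ne _ _
      have e2 : ∀ ω, PrefixBound A σ k (Function.update p k ω) ↔ PrefixBound A σ k p := by
        intro ω
        unfold PrefixBound
        refine forall_congr' fun u => ?_
        have : ∀ i : Fin m, (if i < k then u i else 0) • A (Function.update p k ω i) =
            (if i < k then u i else 0) • A (p i) := fun i => by
          split_ifs with hi
          · rw [hup i hi]
          · simp
        simp only [this]
      have e3 : ∀ ω, upperCol A k (Function.update p k ω) ⬝ᵥ u =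
          A ω ⬝ᵥ (∑ j, (if j < k then u j else 0) • A (p j)) := by
        intro ω
        rw [dotProduct_sum, dotProduct]
        refine Finset.sum_congr rfl fun j _ => ?_
        unfold upperCol
        rw [dotProduct_smul, smul_eq_mul]
        split_ifs with hj
        · rw [hup j hj, Function.update_self, dotProduct_comm, mul_comm]
        · simp
      by_cases hp : PrefixBound A σ k p
      · refine le_trans ?_ (hp u)
        rw [← hiso]
        refine integral_mono_of_nonneg (ae_of_all _ fun ω => sq_nonneg _) (hint _)
          (ae_of_all _ fun ω => ?_)
        change (truncUpperCol A (m * κ) σ k (Function.update p k ω) ⬝ᵥ u) ^ 2 ≤ (A ω ⬝ᵥ _) ^ 2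
        rw [← e3]
        simp only [truncUpperCol, k.2, dite_true]
        split_ifs
        · exact le_rfl
        · simpa using sq_nonneg _
      · have : ∀ ω, truncUpperCol A (m * κ) σ k (Function.update p k ω) = 0 := fun ω => by
          simp only [truncUpperCol, k.2, dite_true, Fin.eta, e2, hp, and_false, if_false]
        simp only [this]
        simpa using mul_nonneg hσ0 (zero_le_dotProduct_self u)) hQ
  rw [Fintype.card_fin] at b2
  rw [add_mul]
  refine le_trans (measureReal_mono ?_) ((measureReal_union_le _ _).trans (add_le_add b1 b2))
  rintro p ⟨hp1, hp2, u, hu⟩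
  by_contra hcon
  rw [Set.mem_union, not_or] at hcon
  obtain ⟨n1, n2⟩ := hcon
  have t1 : ∀ k : Fin m, truncVec A R k p = A (p k) := fun k => by
    simp [truncVec, hp1]
  have f1 : ∀ v : ι → ℝ, ∑ j, (A (p j) ⬝ᵥ v) ^ 2 ≤ σ * (v ⬝ᵥ v) := by
    intro v
    by_contra! hv
    refine n1 ⟨v, ?_⟩
    rw [Finset.sum_range]
    simpa only [t1] using hv
  have f2 : ∀ k : Fin m, PrefixBound A σ k p := fun k v => by
    refine (dotProduct_sum_smul_self_le hσ0 f1 _).trans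
      (mul_le_mul_of_nonneg_left (Finset.sum_le_sum fun j _ => ?_) hσ0)
    dsimp only
    split_ifs
    · exact le_rfl
    · simpa using mul_self_nonneg (v j)
  have f3 : ∀ k : Fin m, upperCol A k p ⬝ᵥ upperCol A k p ≤ m * κ := fun k => by
    refine (Finset.sum_le_card_nsmul _ _ κ fun j _ => ?_).trans_eq (by simp)
    unfold upperCol
    split_ifs with hj
    · rw [← sq]; exact hp2 j k hj
    · simpa using hκ.le
  have t2 : ∀ k : Fin m, truncUpperCol A (m * κ) σ k p = upperCol A k p := fun k => by
    simp [truncUpperCol, f2, f3]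
  refine n2 ⟨u, ?_⟩
  rw [Finset.sum_range]
  simpa only [t2] using hu

end IsotropicGram

section OpNorm

open Matrix

variable {m : ℕ}

theorem opNorm_le_of_forall {A : Matrix (Fin m) (Fin m) ℝ} {c : ℝ} (hc : 0 ≤ c)
    (h : ∀ u, (A *ᵥ u) ⬝ᵥ (A *ᵥ u) ≤ c ^ 2 * (u ⬝ᵥ u)) : opNorm A ≤ c := by
  refine ContinuousLinearMap.opNorm_le_bound _ hc fun u => ?_
  have e : ∀ v : EuclideanSpace ℝ (Fin m), ‖v‖ ^ 2 = v.ofLp ⬝ᵥ v.ofLp := fun v => by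
    rw [EuclideanSpace.real_norm_sq_eq]
    exact Finset.sum_congr rfl fun i _ => sq _
  refine (sq_le_sq₀ (norm_nonneg _) (by positivity)).1 ?_
  rw [mul_pow, e, e]
  exact h u.ofLp

theorem opNorm_add_le (A B : Matrix (Fin m) (Fin m) ℝ) : opNorm (A + B) ≤ opNorm A + opNorm B := by
  unfold opNorm
  rw [map_add]
  exact norm_add_le _ _

theorem opNorm_transpose (A : Matrix (Fin m) (Fin m) ℝ) : opNorm Aᵀ = opNorm A := by
  unfold opNorm
  rw [← conjTranspose_eq_transpose_of_trivial, ← star_eq_conjTranspose, map_star,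
    ContinuousLinearMap.star_eq_adjoint, LinearIsometryEquiv.norm_map]

theorem opNorm_diagonal_le {v : Fin m → ℝ} {c : ℝ} (hc : 0 ≤ c) (h : ∀ i, |v i| ≤ c) :
    opNorm (diagonal v) ≤ c := by
  refine opNorm_le_of_forall hc fun u => ?_
  rw [dotProduct, dotProduct, Finset.mul_sum]
  refine Finset.sum_le_sum fun i _ => ?_
  rw [mulVec_diagonal]
  have h1 : v i ^ 2 ≤ c ^ 2 := sq_le_sq' (abs_le.1 (h i)).1 (abs_le.1 (h i)).2
  nlinarith [mul_self_nonneg (u i)]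

theorem opNorm_offDiagPart_le {G : Matrix (Fin m) (Fin m) ℝ} (hG : Gᵀ = G) {c : ℝ} (hc : 0 ≤ c)
    (h : ∀ u : Fin m → ℝ,
      ∑ k, ((fun j => if j < k then G j k else 0) ⬝ᵥ u) ^ 2 ≤ c ^ 2 * (u ⬝ᵥ u)) :
    opNorm (offDiagPart G) ≤ 2 * c := by
  set L : Matrix (Fin m) (Fin m) ℝ := Matrix.of fun k j => if j < k then G j k else 0 with hL
  have h1 : opNorm L ≤ c := opNorm_le_of_forall hc fun u => by
    refine le_trans (le_of_eq ?_) (h u)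
    exact Finset.sum_congr rfl fun k _ => (sq _).symm
  have h2 : offDiagPart G = L + Lᵀ := by
    ext i j
    have hs : G j i = G i j := congrFun (congrFun hG i) j
    simp only [offDiagPart, hL, Matrix.sub_apply, Matrix.add_apply, transpose_apply, of_apply, diagonal_apply,
      diag_apply]
    rcases lt_trichotomy i j with hij | hij | hij
    · simp [hij, hij.ne, hij.not_gt]
    · subst hij; simp
    · simp [hij, hij.ne', hij.not_gt, hs]
  rw [h2]
  refine (opNorm_add_le _ _).trans ?_
  rw [opNorm_transpose]
  linarith

theorem opNorm_sub_one_le {G : Matrix (Fin m) (Fin m) ℝ} {c : ℝ} (hc : 0 ≤ c)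
    (h : ∀ i, |G i i - 1| ≤ c) : opNorm (G - 1) ≤ opNorm (offDiagPart G) + c := by
  have e : G - 1 = offDiagPart G + diagonal fun i => G i i - 1 := by
    ext i j
    by_cases hij : i = j
    · subst hij; simp [offDiagPart]
    · simp [offDiagPart, hij]
  rw [e]
  exact (opNorm_add_le _ _).trans (add_le_add le_rfl (opNorm_diagonal_le hc h))

end OpNorm

section Sample

variable {n m d : ℕ}

instance isProbabilityMeasure_samplePoints (n m : ℕ) :
    IsProbabilityMeasure (samplePoints n m) := by
  unfold samplePoints; infer_instance

theorem interpM_apply (p : Fin m → Fin n → ℝ) (i j : Fin m) :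
    interpM d p i j = kernel d (p i) (p j) / Fintype.card (HermiteIndex n d) := by
  rw [interpM, interpC_eq_card, Matrix.smul_apply, Matrix.mul_apply, smul_eq_mul, mul_comm,
    div_eq_mul_inv]
  rfl

theorem interpM_transpose (p : Fin m → Fin n → ℝ) : (interpM d p).transpose = interpM d p := by
  rw [interpM, Matrix.transpose_smul, Matrix.transpose_mul, Matrix.transpose_transpose]

theorem measureReal_exists_norm_gt_le {ε : ℝ} (hε0 : 0 ≤ ε) (hε1 : ε ≤ 1) :
    (samplePoints n m).real {p : Fin m → Fin n → ℝ | ∃ i, ε * n < |p i ⬝ᵥ p i - n|} ≤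
      m * (2 * Real.exp (-(n * ε ^ 2 / 16))) := by
  have e : {p : Fin m → Fin n → ℝ | ∃ i, ε * n < |p i ⬝ᵥ p i - n|} =
      ⋃ i, {p : Fin m → Fin n → ℝ | ε * n < |p i ⬝ᵥ p i - n|} := by
    ext p; simp
  rw [e]
  refine (measureReal_iUnion_fintype_le _).trans ?_
  refine (Finset.sum_le_card_nsmul _ _ _ fun i _ => ?_).trans_eq (by
    rw [Finset.card_univ, Fintype.card_fin, nsmul_eq_mul])
  have hm : MeasurableSet {x : Fin n → ℝ | ε * n < |x ⬝ᵥ x - n|} :=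
    measurableSet_lt measurable_const
      ((measurable_dotProduct measurable_id measurable_id).sub_const _).abs
  have h := (measurePreserving_eval (fun _ : Fin m => stdNormal n) i).measureReal_preimage
    hm.nullMeasurableSet
  exact h.trans_le (measureReal_abs_dotProduct_self_sub_le hε0 hε1)

theorem measureReal_inner_gt_le (hn : 1 ≤ n) {i j : Fin m} (hij : i ≠ j) {u : ℝ} (hu : 0 ≤ u) :
    (samplePoints n m).real {p | p i ⬝ᵥ p i ≤ 2 * n ∧ u < |p i ⬝ᵥ p j|} ≤
      2 * Real.exp (-(u ^ 2 / (4 * n))) := by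
  have hn0 : (0 : ℝ) < n := by exact_mod_cast hn
  have hmi : ∀ i j : Fin m, Measurable fun p : Fin m → Fin n → ℝ => p i ⬝ᵥ p j := fun i j =>
    measurable_dotProduct (measurable_pi_apply i) (measurable_pi_apply j)
  set S : Set (Fin m → Fin n → ℝ) := {p | p i ⬝ᵥ p i ≤ 2 * n ∧ u < |p i ⬝ᵥ p j|} with hS
  have hSm : MeasurableSet S := (measurableSet_le (hmi i i) measurable_const).inter
    (measurableSet_lt measurable_const (hmi i j).abs)
  have hI : Integrable (S.indicator fun _ => (1 : ℝ)) (Measure.pi fun _ : Fin m => stdNormal n) :=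
    (integrable_const 1).indicator hSm
  obtain ⟨h1, h2⟩ := integral_pi_eq_integral_update (stdNormal n) j hI
  have h3 : (samplePoints n m).real S =
      ∫ p, S.indicator (fun _ => (1 : ℝ)) p ∂(Measure.pi fun _ : Fin m => stdNormal n) := by
    rw [integral_indicator_const _ hSm, smul_eq_mul, mul_one, samplePoints]
  rw [h3, h2]
  refine (integral_mono h1 (integrable_const (2 * Real.exp (-(u ^ 2 / (4 * n))))) fun p => ?_).trans_eq
    (by simp)
  have hpre : MeasurableSet {ω | Function.update p j ω ∈ S} := measurable_update p hSm
  have h4 : ∫ ω, S.indicator (fun _ => (1 : ℝ)) (Function.update p j ω) ∂(stdNormal n) =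
      (stdNormal n).real {ω | Function.update p j ω ∈ S} := by
    have : (fun ω => S.indicator (fun _ => (1 : ℝ)) (Function.update p j ω)) =
        Set.indicator {ω | Function.update p j ω ∈ S} fun _ => (1 : ℝ) := by
      funext ω
      simp [Set.indicator_apply]
    rw [this, integral_indicator_const _ hpre, smul_eq_mul, mul_one]
  change ∫ ω, S.indicator (fun _ => (1 : ℝ)) (Function.update p j ω) ∂(stdNormal n) ≤ _
  rw [h4]
  by_cases hp : p i ⬝ᵥ p i ≤ 2 * n
  · refine (measureReal_mono ?_).trans ((measureReal_abs_dotProduct_gt_le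
      (by positivity : (0 : ℝ) < 2 * n) hp hu).trans_eq ?_)
    · intro ω hω
      have h5 := hω.2
      rw [Function.update_self, Function.update_of_ne hij] at h5
      exact h5
    · rw [← mul_assoc]; norm_num
  · have : {ω | Function.update p j ω ∈ S} = ∅ := by
      refine Set.eq_empty_of_forall_notMem fun ω hω => hp ?_
      have h5 := hω.1
      rwa [Function.update_of_ne hij] at h5
    rw [this]
    simp only [measureReal_empty]
    positivity

theorem measureReal_exists_inner_gt_le (hn : 1 ≤ n) {u : ℝ} (hu : 0 ≤ u) :
    (samplePoints n m).real {p : Fin m → Fin n → ℝ | ∃ i j, i < j ∧ p i ⬝ᵥ p i ≤ 2 * n ∧ u < |p i ⬝ᵥ p j|} ≤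
      m * (m * (2 * Real.exp (-(u ^ 2 / (4 * n))))) := by
  have e : {p : Fin m → Fin n → ℝ | ∃ i j, i < j ∧ p i ⬝ᵥ p i ≤ 2 * n ∧ u < |p i ⬝ᵥ p j|} =
      ⋃ i, ⋃ j, {p : Fin m → Fin n → ℝ | i < j ∧ p i ⬝ᵥ p i ≤ 2 * n ∧ u < |p i ⬝ᵥ p j|} := by
    ext p; simp
  rw [e]
  refine (measureReal_iUnion_fintype_le _).trans ?_
  refine (Finset.sum_le_card_nsmul _ _ _ fun i _ => ?_).trans_eq (by
    rw [Finset.card_univ, Fintype.card_fin, nsmul_eq_mul])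
  refine (measureReal_iUnion_fintype_le _).trans ?_
  refine (Finset.sum_le_card_nsmul _ _ _ fun j _ => ?_).trans_eq (by
    rw [Finset.card_univ, Fintype.card_fin, nsmul_eq_mul])
  by_cases hij : i < j
  · refine (measureReal_mono ?_).trans (measureReal_inner_gt_le hn hij.ne hu)
    exact fun p hp => hp.2
  · have : {p : Fin m → Fin n → ℝ | i < j ∧ p i ⬝ᵥ p i ≤ 2 * n ∧ u < |p i ⬝ᵥ p j|} = ∅ :=
      Set.eq_empty_of_forall_notMem fun p hp => hij hp.1
    rw [this]
    simp only [measureReal_empty]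
    positivity

/-- The three ways in which a sample can fail to have a well-behaved Gram matrix are unlikely;
outside of them, the Gram matrix is close to diagonal. -/
theorem measureReal_gram_ge {c : ℝ} (hc : 0 ≤ c) (hd : 1 ≤ d) (hn : 1 ≤ n)
    (hdiag : ∀ ε : ℝ, ε ≤ 1 → ∀ p : Fin n → ℝ, |p ⬝ᵥ p - n| ≤ ε * n →
      |kernel d p p / Fintype.card (HermiteIndex n d) - 1| ≤ c * (ε + 1 / n))
    {ε l R κ τ : ℝ} (hε0 : 0 ≤ ε) (hε1 : ε ≤ 1) (hl : 1 ≤ l) {Q : ℕ} (hQ : 0 < Q)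
    (hR : R = (1 + 2 * c) * (d * n ^ d)) (hκ : κ = (d * (4 * (√n * l)) ^ d) ^ 2)
    (hτ : τ = Real.exp 1 * (Q * (m * κ) +
      Real.exp 1 * (Real.exp 1 * (Q * R + Real.exp 1 * 1 * m)) * m)) :
    1 - (m * (2 * Real.exp (-(n * ε ^ 2 / 16))) + m * (m * (2 * Real.exp (-(l ^ 2 / 4)))) +
      (d * n ^ d + m) * Real.exp (-Q)) ≤
    (samplePoints n m).real {p |
      opNorm (offDiagPart (interpM d p)) ≤ 2 * (√τ / Fintype.card (HermiteIndex n d)) ∧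
      ∀ i, |interpM d p i i - 1| ≤ c * (ε + 1 / n)} := by
  have hn1 : (1 : ℝ) ≤ n := by exact_mod_cast hn
  have hn0 : (0 : ℝ) < n := by linarith
  have hd0 : (0 : ℝ) < d := by exact_mod_cast hd
  have hl0 : 0 < l := by linarith
  have hs0 : 0 < √(n : ℝ) := Real.sqrt_pos.2 hn0
  have hR0 : 0 < R := by rw [hR]; positivity
  have hκ0 : 0 < κ := by rw [hκ]; positivity
  have hτ0 : 0 ≤ τ := by rw [hτ]; positivity
  obtain ⟨N1, N2, -⟩ := card_hermiteIndex_bounds (d := d) hd hn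
  have hN : (0 : ℝ) < Fintype.card (HermiteIndex n d) := lt_of_lt_of_le (by positivity) N1
  set G := {p : Fin m → Fin n → ℝ |
      opNorm (offDiagPart (interpM d p)) ≤ 2 * (√τ / Fintype.card (HermiteIndex n d)) ∧
      ∀ i, |interpM d p i i - 1| ≤ c * (ε + 1 / n)} with hG
  set A : (Fin n → ℝ) → HermiteIndex n d → ℝ := fun x I => multiHermite I x with hA
  have hAm : Measurable A := measurable_pi_iff.2 fun I => (continuous_multiHermite I).measurable
  have b1 := measureReal_exists_norm_gt_le (n := n) (m := m) hε0 hε1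
  have b2 := measureReal_exists_inner_gt_le (n := n) (m := m) hn (u := √n * l) (by positivity)
  have b3 := measureReal_upperCol_le (m := m) (stdNormal n) hAm
    (fun v => integrable_sum_multiHermite_sq v)
    (fun v => (integral_sum_multiHermite_sq v).trans (Finset.sum_congr rfl fun I _ => sq _))
    hR0 hκ0 hQ
  rw [← hτ] at b3
  set B1 := {p : Fin m → Fin n → ℝ | ∃ i, ε * n < |p i ⬝ᵥ p i - n|}
  set B2 := {p : Fin m → Fin n → ℝ | ∃ i j, i < j ∧ p i ⬝ᵥ p i ≤ 2 * n ∧ √n * l < |p i ⬝ᵥ p j|}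
  set B3 := {p : Fin m → Fin n → ℝ | (∀ i, A (p i) ⬝ᵥ A (p i) ≤ R) ∧
      (∀ i j, i < j → (A (p i) ⬝ᵥ A (p j)) ^ 2 ≤ κ) ∧ ∃ u : Fin m → ℝ,
      τ * (u ⬝ᵥ u) < ∑ k, (upperCol A k p ⬝ᵥ u) ^ 2}
  have e1 : (√(n : ℝ) * l) ^ 2 / (4 * n) = l ^ 2 / 4 := by
    rw [mul_pow, Real.sq_sqrt hn0.le]
    field_simp
  rw [e1] at b2
  have hcover : (Set.univ : Set (Fin m → Fin n → ℝ)) ⊆ G ∪ (B1 ∪ B2 ∪ B3) := by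
    intro p _
    by_contra hcon
    simp only [Set.mem_union, not_or] at hcon
    obtain ⟨hGp, ⟨h1, h2⟩, h3⟩ := hcon
    have g1 : ∀ i, |p i ⬝ᵥ p i - n| ≤ ε * n := fun i => by
      by_contra! h
      exact h1 ⟨i, h⟩
    have g1' : ∀ i, p i ⬝ᵥ p i ≤ 2 * n := fun i => by
      have := (abs_le.1 (g1 i)).2
      nlinarith
    have g2 : ∀ i j, i < j → |p i ⬝ᵥ p j| ≤ √n * l := fun i j hij => by
      by_contra! h
      exact h2 ⟨i, j, hij, g1' i, h⟩
    have g3 : ∀ i, |kernel d (p i) (p i) / Fintype.card (HermiteIndex n d) - 1| ≤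
        c * (ε + 1 / n) := fun i => hdiag ε hε1 (p i) (g1 i)
    have g4 : ∀ i, A (p i) ⬝ᵥ A (p i) ≤ R := fun i => by
      have h := (abs_le.1 (g3 i)).2
      have hle : ε + 1 / n ≤ 2 := by
        have : 1 / (n : ℝ) ≤ 1 := by rw [div_le_one hn0]; exact hn1
        linarith
      have h' : kernel d (p i) (p i) / Fintype.card (HermiteIndex n d) ≤ 1 + 2 * c := by
        have := mul_le_mul_of_nonneg_left hle hc
        linarith
      rw [div_le_iff₀ hN] at h'
      rw [hR]
      exact h'.trans (mul_le_mul_of_nonneg_left N2 (by positivity))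
    have g5 : ∀ i j, i < j → (A (p i) ⬝ᵥ A (p j)) ^ 2 ≤ κ := fun i j hij => by
      have h := abs_kernel_le (d := d) (p := p i) (q := p j) (W := √n * l)
        (one_le_mul_of_one_le_of_one_le (by rw [Real.one_le_sqrt]; exact hn1) hl)
        (by
          rw [mul_pow, Real.sq_sqrt hn0.le]
          exact le_mul_of_one_le_right hn0.le (one_le_pow₀ hl))
        (g2 i j hij) (g1' i) (g1' j)
      rw [hκ]
      exact sq_le_sq' (abs_le.1 h).1 (abs_le.1 h).2
    have g6 : ∀ u : Fin m → ℝ, ∑ k, (upperCol A k p ⬝ᵥ u) ^ 2 ≤ τ * (u ⬝ᵥ u) := fun u => by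
      by_contra! h
      exact h3 ⟨g4, g5, u, h⟩
    refine hGp ⟨?_, fun i => by rw [interpM_apply]; exact g3 i⟩
    refine opNorm_offDiagPart_le (interpM_transpose p) (by positivity) fun u => ?_
    have e2 : ∀ k : Fin m, (fun j => if j < k then interpM d p j k else 0) ⬝ᵥ u =
        (upperCol A k p ⬝ᵥ u) / Fintype.card (HermiteIndex n d) := fun k => by
      rw [dotProduct, dotProduct, Finset.sum_div]
      refine Finset.sum_congr rfl fun j _ => ?_
      unfold upperCol
      split_ifs with hj
      · rw [interpM_apply, div_mul_eq_mul_div]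
        rfl
      · simp
    simp only [e2, div_pow]
    rw [← Finset.sum_div, Real.sq_sqrt hτ0, div_mul_eq_mul_div]
    exact div_le_div_of_nonneg_right (g6 u) (by positivity)
  have htot : (1 : ℝ) ≤ (samplePoints n m).real G + (samplePoints n m).real (B1 ∪ B2 ∪ B3) := by
    rw [← probReal_univ (μ := samplePoints n m)]
    exact (measureReal_mono hcover).trans (measureReal_union_le _ _)
  have h12 := measureReal_union_le (μ := samplePoints n m) (B1 ∪ B2) B3
  have h12' := measureReal_union_le (μ := samplePoints n m) B1 B2
  have b3' : (samplePoints n m).real B3 ≤ (d * n ^ d + m) * Real.exp (-Q) :=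
    b3.trans (mul_le_mul_of_nonneg_right (by linarith) (Real.exp_pos _).le)
  linarith

end Sample

section Asymptotics

theorem tendsto_log_natCast : Tendsto (fun n : ℕ => Real.log n) atTop atTop :=
  Real.tendsto_log_atTop.comp tendsto_natCast_atTop_atTop

theorem eventually_log_sq_le : ∀ᶠ n : ℕ in atTop, Real.log n ^ 2 ≤ √n / 4 := by
  have h := (Real.isLittleO_pow_log_id_atTop (n := 4)).bound (by norm_num : (0 : ℝ) < 1 / 16)
  filter_upwards [tendsto_natCast_atTop_atTop.eventually h] with n hn
  have h1 : (Real.log n ^ 2) ^ 2 ≤ n / 16 := by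
    rw [← pow_mul]
    have := (le_abs_self _).trans hn
    simp only [id, Real.norm_eq_abs, Nat.abs_cast] at this
    linarith
  have h2 := Real.le_sqrt_of_sq_le h1
  rwa [Real.sqrt_div' _ (by norm_num), show √(16 : ℝ) = 4 by
    rw [show (16 : ℝ) = 4 ^ 2 by norm_num]; exact Real.sqrt_sq (by norm_num)] at h2

theorem failure_probability_le {n d m : ℕ} {l β ε : ℝ} {Q : ℕ} (hn : 1 ≤ n) (hnl : Real.log n = l)
    (hl1 : 1 ≤ l) (hl : 4 * (3 * d + 5 + |β|) ≤ l) (hε : l ^ 2 / 4 ≤ n * ε ^ 2 / 16)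
    (hQ : l ^ 2 ≤ Q) (hm : (m : ℝ) ≤ n ^ d) :
    m * (2 * Real.exp (-(n * ε ^ 2 / 16))) + m * (m * (2 * Real.exp (-(l ^ 2 / 4)))) +
      (d * n ^ d + m) * Real.exp (-Q) ≤ (n : ℝ) ^ (-β) := by
  have hn1 : (1 : ℝ) ≤ n := by exact_mod_cast hn
  have hn0 : (0 : ℝ) < n := by linarith
  set E := Real.exp (-(l ^ 2 / 4))
  have hE0 : 0 < E := Real.exp_pos _
  have e1 : Real.exp (-(n * ε ^ 2 / 16)) ≤ E := Real.exp_le_exp.2 (by linarith)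
  have e2 : Real.exp (-Q) ≤ E := Real.exp_le_exp.2 (by nlinarith [sq_nonneg l])
  set M : ℝ := (n : ℝ) ^ d
  have hM1 : 1 ≤ M := one_le_pow₀ hn1
  have hm0 : (0 : ℝ) ≤ m := Nat.cast_nonneg m
  have hd0 : (0 : ℝ) ≤ d := Nat.cast_nonneg d
  have hMM : M ≤ M * M := le_mul_of_one_le_left (by linarith) hM1
  have hmm : (m : ℝ) * m ≤ M * M := mul_le_mul hm hm hm0 (by linarith)
  have t1 : m * (2 * Real.exp (-(n * ε ^ 2 / 16))) ≤ M * M * (2 * E) :=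
    mul_le_mul (hm.trans hMM) (by linarith) (by positivity) (by positivity)
  have t2 : m * (m * (2 * E)) ≤ M * M * (2 * E) := by
    rw [← mul_assoc]
    exact mul_le_mul_of_nonneg_right hmm (by positivity)
  have t3 : (d * M + m) * Real.exp (-Q) ≤ (d + 1) * (M * M) * E := by
    refine mul_le_mul ?_ e2 (Real.exp_pos _).le (by positivity)
    have := mul_le_mul_of_nonneg_left hMM hd0
    linarith
  have hMexp : M = Real.exp (d * l) := by
    rw [Real.exp_nat_mul, ← hnl, Real.exp_log hn0]
  have t4 : (d : ℝ) + 5 ≤ Real.exp (d + 5) := by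
    linarith [Real.add_one_le_exp ((d : ℝ) + 5)]
  calc _ ≤ M * M * (2 * E) + M * M * (2 * E) + (d + 1) * (M * M) * E :=
        add_le_add (add_le_add t1 t2) t3
    _ = (d + 5) * (M * M * E) := by ring
    _ ≤ Real.exp (d + 5) * (M * M * E) := by gcongr
    _ = Real.exp ((d + 5) + (d * l + d * l + -(l ^ 2 / 4))) := by
        rw [hMexp, ← Real.exp_add, ← Real.exp_add, ← Real.exp_add]
    _ ≤ Real.exp (Real.log n * (-β)) := by
        refine Real.exp_le_exp.2 ?_
        rw [hnl]
        have h1 := mul_le_mul_of_nonneg_right hl (by linarith : 0 ≤ l)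
        have h2 := mul_le_mul_of_nonneg_right (le_abs_self β) (by linarith : 0 ≤ l)
        have h3 := mul_le_mul_of_nonneg_left hl1 (by linarith : (0 : ℝ) ≤ d + 5)
        nlinarith only [h1, h2, h3]
    _ = (n : ℝ) ^ (-β) := by rw [Real.rpow_def_of_pos hn0]

theorem two_mul_sqrt_div_le {n d m : ℕ} {c l R κ τ N : ℝ} {Q : ℕ} (hc : 0 ≤ c) (hn : 1 ≤ n)
    (hl1 : 1 ≤ l) (hQ : (Q : ℝ) ≤ 2 * l ^ 2) (hm : (m : ℝ) ≤ n ^ d)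
    (hR : R = (1 + 2 * c) * (d * n ^ d)) (hκ : κ = (d * (4 * (√n * l)) ^ d) ^ 2)
    (hτ : τ = Real.exp 1 * (Q * (m * κ) +
      Real.exp 1 * (Real.exp 1 * (Q * R + Real.exp 1 * 1 * m)) * m))
    (hN : (n : ℝ) ^ d / d.factorial ≤ N)
    (hl : 2 * √(Real.exp 1 * (2 * (d ^ 2 * 16 ^ d) +
      Real.exp 1 ^ 2 * (2 * ((1 + 2 * c) * d) + Real.exp 1))) * d.factorial ≤ l) :
    2 * (√τ / N) ≤ l ^ (d + 2) * (√m / (n : ℝ) ^ ((d : ℝ) / 2)) := by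
  have hn1 : (1 : ℝ) ≤ n := by exact_mod_cast hn
  have hn0 : (0 : ℝ) < n := by linarith
  set T : ℝ := (n : ℝ) ^ ((d : ℝ) / 2)
  have hT0 : 0 < T := Real.rpow_pos_of_pos hn0 _
  have hTT : T ^ 2 = n ^ d := by
    rw [← Real.rpow_natCast, ← Real.rpow_mul hn0.le]
    norm_num
  set E := Real.exp 1
  have hE : 0 < E := Real.exp_pos 1
  set c₁ := E * (2 * (d ^ 2 * 16 ^ d) + E ^ 2 * (2 * ((1 + 2 * c) * d) + E)) with hc₁
  have hc₁0 : 0 ≤ c₁ := by positivity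
  have hl2 : 1 ≤ l ^ 2 := one_le_pow₀ hl1
  have hm0 : (0 : ℝ) ≤ m := Nat.cast_nonneg m
  have hκ' : κ = d ^ 2 * 16 ^ d * T ^ 2 * (l ^ d) ^ 2 := by
    have h1 : (√(n : ℝ) ^ d) ^ 2 = n ^ d := by
      rw [← pow_mul, mul_comm d 2, pow_mul, Real.sq_sqrt hn0.le]
    have h2 : ((4 : ℝ) ^ d) ^ 2 = 16 ^ d := by
      rw [← pow_mul, mul_comm d 2, pow_mul]; norm_num
    rw [hκ, mul_pow 4, mul_pow, mul_pow, h2, mul_pow √(n : ℝ), mul_pow, h1, hTT]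
    ring
  have hld : 1 ≤ (l ^ d) ^ 2 := one_le_pow₀ (one_le_pow₀ hl1)
  have hτ' : τ ≤ c₁ * m * T ^ 2 * (l ^ (d + 1)) ^ 2 := by
    have h1 : Q * (m * κ) ≤ 2 * l ^ 2 * (m * κ) :=
      mul_le_mul_of_nonneg_right hQ (by rw [hκ]; positivity)
    have h2 : Q * R ≤ 2 * l ^ 2 * R := mul_le_mul_of_nonneg_right hQ (by rw [hR]; positivity)
    have h3 : Q * R + E * 1 * m ≤ (2 * ((1 + 2 * c) * d) + E) * T ^ 2 * l ^ 2 := by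
      have h4 : E * 1 * m ≤ E * (T ^ 2 * l ^ 2) := by
        rw [mul_one, hTT]
        exact mul_le_mul_of_nonneg_left
          (hm.trans (le_mul_of_one_le_right (by positivity) hl2)) hE.le
      rw [hR, ← hTT] at h2
      rw [hR, ← hTT]
      linarith only [h2, h4]
    have h5 : E * (E * (Q * R + E * 1 * m)) * m ≤
        E * (E * ((2 * ((1 + 2 * c) * d) + E) * T ^ 2 * l ^ 2)) * m * (l ^ d) ^ 2 := by
      refine le_trans ?_ (le_mul_of_one_le_right (by positivity) hld)
      gcongr
    rw [hτ]
    calc _ ≤ E * (2 * l ^ 2 * (m * κ) +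
          E * (E * ((2 * ((1 + 2 * c) * d) + E) * T ^ 2 * l ^ 2)) * m * (l ^ d) ^ 2) := by gcongr
      _ = _ := by rw [hκ', hc₁]; ring
  have hsq : √τ ≤ √c₁ * √m * T * l ^ (d + 1) := by
    refine (Real.sqrt_le_sqrt hτ').trans_eq ?_
    rw [Real.sqrt_mul (by positivity), Real.sqrt_mul (by positivity), Real.sqrt_mul hc₁0,
      Real.sqrt_sq hT0.le, Real.sqrt_sq (by positivity)]
  have hf : (0 : ℝ) < d.factorial := by positivity
  have hNpos : 0 < N := lt_of_lt_of_le (by positivity) hN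
  calc 2 * (√τ / N) ≤ 2 * ((√c₁ * √m * T * l ^ (d + 1)) / (T ^ 2 / d.factorial)) := by
        rw [hTT]
        gcongr
    _ = (2 * √c₁ * d.factorial) * (l ^ (d + 1) * (√m / T)) := by
        field_simp
    _ ≤ l * (l ^ (d + 1) * (√m / T)) := by gcongr
    _ = _ := by ring

/-- With overwhelming probability the off-diagonal part of the Gram matrix is small and its
diagonal is close to one. -/
theorem exists_eventually_gram_bounds (d : ℕ) (hd : 1 ≤ d) : ∃ c : ℝ, 0 ≤ c ∧ ∀ β : ℝ,
    ∀ᶠ n : ℕ in atTop, ∀ m : ℕ, (m : ℝ) ≤ n ^ d → 1 - (n : ℝ) ^ (-β) ≤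
      (samplePoints n m).real {p : Fin m → Fin n → ℝ |
        opNorm (offDiagPart (interpM d p)) ≤
          Real.log n ^ (d + 2) * (√m / (n : ℝ) ^ ((d : ℝ) / 2)) ∧
        ∀ i, |interpM d p i i - 1| ≤ c * ((√√n)⁻¹ + 1 / n)} := by
  obtain ⟨c, hc, hdiag⟩ := exists_abs_kernel_self_div_card_sub_one_le hd
  refine ⟨c, hc, fun β => ?_⟩
  filter_upwards [eventually_ge_atTop 1, tendsto_log_natCast.eventually_ge_atTop 1,
    tendsto_log_natCast.eventually_ge_atTop (4 * (3 * d + 5 + |β|)),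
    tendsto_log_natCast.eventually_ge_atTop (2 * √(Real.exp 1 * (2 * (d ^ 2 * 16 ^ d) +
      Real.exp 1 ^ 2 * (2 * ((1 + 2 * c) * d) + Real.exp 1))) * d.factorial),
    eventually_log_sq_le] with n hn hl1 hlβ hlc hsq m hm
  have hn1 : (1 : ℝ) ≤ n := by exact_mod_cast hn
  have hs1 : 1 ≤ √(n : ℝ) := by rwa [Real.one_le_sqrt]
  have hss1 : 1 ≤ √√(n : ℝ) := by rwa [Real.one_le_sqrt]
  set l := Real.log n with hl
  set ε : ℝ := (√√n)⁻¹ with hε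
  have hε0 : 0 ≤ ε := by positivity
  have hε1 : ε ≤ 1 := inv_le_one_of_one_le₀ hss1
  have hnε : n * ε ^ 2 = √n := by
    rw [hε, inv_pow, Real.sq_sqrt (Real.sqrt_nonneg _), ← div_eq_mul_inv, Real.div_sqrt]
  have hl2 : 1 ≤ l ^ 2 := one_le_pow₀ hl1
  set Q := ⌈l ^ 2⌉₊ with hQdef
  have hQ0 : 0 < Q := Nat.ceil_pos.2 (by linarith)
  have hQ1 : l ^ 2 ≤ Q := Nat.le_ceil _
  have hQ2 : (Q : ℝ) ≤ 2 * l ^ 2 := by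
    have := Nat.ceil_lt_add_one (sq_nonneg l)
    linarith
  have h := measureReal_gram_ge (m := m) hc hd hn (hdiag n hn) hε0 hε1 hl1 hQ0 rfl rfl rfl
  have hf := failure_probability_le (β := β) (ε := ε) (Q := Q) hn hl.symm hl1 hlβ
    (by rw [hnε]; linarith) hQ1 hm
  refine le_trans (by linarith) (h.trans (measureReal_mono fun p hp => ⟨hp.1.trans ?_, hp.2⟩))
  exact two_mul_sqrt_div_le hc hn hl1 hQ2 hm rfl rfl rfl
    (card_hermiteIndex_bounds hd hn).1 hlc

theorem tendsto_log_pow_mul_rpow_neg (K : ℕ) {δ : ℝ} (hδ : 0 < δ) :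
    Tendsto (fun n : ℕ => Real.log n ^ K * (n : ℝ) ^ (-δ)) atTop (𝓝 0) := by
  have h := (isLittleO_log_rpow_rpow_atTop (K : ℝ) hδ).tendsto_div_nhds_zero
  refine (h.comp tendsto_natCast_atTop_atTop).congr fun n => ?_
  simp only [Function.comp, Real.rpow_natCast]
  rw [Real.rpow_neg (Nat.cast_nonneg n), div_eq_mul_inv]

theorem sqrt_div_rpow_le {n m d : ℕ} {δ : ℝ} (hn : 1 ≤ n)
    (hm : (m : ℝ) ≤ (n : ℝ) ^ ((d : ℝ) - δ)) :
    √m / (n : ℝ) ^ ((d : ℝ) / 2) ≤ (n : ℝ) ^ (-(δ / 2)) := by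
  have hn0 : (0 : ℝ) < n := by exact_mod_cast hn
  rw [div_le_iff₀ (Real.rpow_pos_of_pos hn0 _), ← Real.rpow_add hn0]
  refine Real.sqrt_le_iff.2 ⟨(Real.rpow_pos_of_pos hn0 _).le, hm.trans_eq ?_⟩
  rw [← Real.rpow_natCast, ← Real.rpow_mul hn0.le]
  congr 1
  push_cast
  ring

theorem natCast_le_pow_of_le_rpow_sub {n m d : ℕ} {δ : ℝ} (hδ : 0 < δ) (hn : 1 ≤ n)
    (hm : (m : ℝ) ≤ (n : ℝ) ^ ((d : ℝ) - δ)) : (m : ℝ) ≤ n ^ d := by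
  rw [← Real.rpow_natCast]
  exact hm.trans (Real.rpow_le_rpow_of_exponent_le (by exact_mod_cast hn) (by linarith))

end Asymptotics
end HermiteGram

theorem mainTheorem6 (d : ℕ) (hd : 1 ≤ d) :
    (∀ δ : ℝ, 0 < δ → ∃ e : ℕ → ℝ, Tendsto e atTop (𝓝 0) ∧
      ∀ β : ℝ, 0 < β → ∀ᶠ n : ℕ in atTop, ∀ m : ℕ, (m : ℝ) ≤ (n : ℝ) ^ ((d : ℝ) - δ) →
        1 - (n : ℝ) ^ (-β) ≤
          (samplePoints n m).real {p | opNorm (interpM d p - 1) ≤ e n}) ∧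
    (∃ K : ℕ, ∀ δ : ℝ, 0 < δ →
      ∀ β : ℝ, 0 < β → ∀ᶠ n : ℕ in atTop, ∀ m : ℕ, (m : ℝ) ≤ (n : ℝ) ^ ((d : ℝ) - δ) →
        1 - (n : ℝ) ^ (-β) ≤
          (samplePoints n m).real {p | opNorm (offDiagPart (interpM d p)) ≤
            Real.log n ^ K * (Real.sqrt m / (n : ℝ) ^ ((d : ℝ) / 2))}) := by
  obtain ⟨c, hc, H⟩ := HermiteGram.exists_eventually_gram_bounds d hd
  refine ⟨fun δ hδ => ⟨fun n => Real.log n ^ (d + 2) * (n : ℝ) ^ (-(δ / 2)) +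
    c * ((√√n)⁻¹ + 1 / n), ?_, fun β _ => ?_⟩, d + 2, fun δ hδ β _ => ?_⟩
  · have h1 := HermiteGram.tendsto_log_pow_mul_rpow_neg (d + 2) (half_pos hδ)
    have h2 : Tendsto (fun n : ℕ => (√√(n : ℝ))⁻¹) atTop (𝓝 0) :=
      tendsto_inv_atTop_zero.comp (Real.tendsto_sqrt_atTop.comp
        (Real.tendsto_sqrt_atTop.comp tendsto_natCast_atTop_atTop))
    have h3 := h1.add ((h2.add (tendsto_one_div_atTop_nhds_zero_nat (𝕜 := ℝ))).const_mul c)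
    simpa using h3
  · filter_upwards [H β, eventually_ge_atTop 1,
      HermiteGram.tendsto_log_natCast.eventually_ge_atTop 0] with n hn hn1 hl m hm
    refine (hn m (HermiteGram.natCast_le_pow_of_le_rpow_sub hδ hn1 hm)).trans
      (measureReal_mono fun p hp => ?_)
    refine (HermiteGram.opNorm_sub_one_le (by positivity) hp.2).trans (add_le_add_left ?_ _)
    exact hp.1.trans (mul_le_mul_of_nonneg_left (HermiteGram.sqrt_div_rpow_le hn1 hm)
      (pow_nonneg hl _))
  · filter_upwards [H β, eventually_ge_atTop 1] with n hn hn1 m hm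
    exact (hn m (HermiteGram.natCast_le_pow_of_le_rpow_sub hδ hn1 hm)).trans
      (measureReal_mono fun p hp => hp.1)
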